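/- Let $\mathbb T\subseteq\mathbb R$ be a time scale (a nonempty closed set), let $a,b\in\mathbb T$ with $a<b$ and $(\mathbb T\setminus\{a,b\})\cap[a,b]\neq\emptyset$, and write $[a,b]$ for the time scale $\{t\in\mathbb T: a\le t\le b\}$, with jump operators $\sigma,\rho$ (taken in $[a,b]$, so $\sigma(b)=b$ and $\rho(a)=a$), delta and nabla derivatives $y^\Delta,y^\nabla$, and delta and nabla integrals. Let $[a,b]^\kappa$ be $[a,b]$ without $b$ if $b$ is left-scattered and $[a,b]$ otherwise, let $[a,b]_\kappa$ be $[a,b]$ without $a$ if $a$ is right-scattered and $[a,b]$ otherwise, and let $[a,b]^\kappa_\kappa=[a,b]^\kappa\cap[a,b]_\kappa$. Write $y^\sigma=y\circ\sigma$, $y^\rho=y\circ\rho$. Let $L_\Delta,L_\nabla:\mathbb T\times\mathbb R^2\to\mathbb R$ be continuous functions whose partial derivatives $\partial_2,\partial_3$ with respect to the second and the third variable exist and are continuous on $\mathbb T\times\mathbb R^2$. Put $G[y](t)=G(t,y^\sigma(t),y^\Delta(t))$, $G\{y\}(t)=G(t,y^\rho(t),y^\nabla(t))$, $$\mathcal J_\Delta(y)=\int_a^b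 L_\Delta[y](t)\,\Delta t,\qquad \mathcal J_\nabla(y)=\int_a^b L_\nabla\{y\}(t)\,\nabla t,\qquad \mathcal J(y)=\mathcal J_\Delta(y)\,\mathcal J_\nabla(y).$$ Let $C^1_\diamond$ be the class of $y:[a,b]\to\mathbb R$ for which $y^\Delta$ exists and is continuous on $[a,b]^\kappa$ and $y^\nabla$ exists and is continuous on $[a,b]_\kappa$. Fix $\alpha,\beta\in\mathbb R$. A function $\hat y\in C^1_\diamond$ with $\hat y(a)=\alpha$, $\hat y(b)=\beta$ is a weak local extremizer of a functional $\mathcal F$ if for some $\delta>0$ either $\mathcal F(\hat y)\le\mathcal F(y)$ for all, or $\mathcal F(\hat y)\ge\mathcal F(y)$ for all, $y\in C^1_\diamond$ with $y(a)=\alpha$, $y(b)=\beta$ and $\|y-\hat y\|_{1,\infty}<\delta$, where $\|y\|_{1,\infty}=\|y^\sigma\|_\infty+\|y^\rho\|_\infty+\|y^\Delta\|_\infty+\|y^\nabla\|_\infty$ and $\|f\|_\infty=\sup_{t\in[a,b]^\kappa_\kappa}|f(t)|$. Suppose that $L_\nabla$ depends only on $t$, i.e. $L_\nabla(t,u,v)=L_\nabla(t)$.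 Then: 1. $\partial_2L_\nabla=\partial_3L_\nabla=0$ on $\mathbb T\times\mathbb R^2$. 2. If $\hat y\in C^1_\diamond$ and $\mathcal J_\nabla(\hat y)\ne0$, then the delta-nabla Euler–Lagrange equation $$\mathcal J_\nabla(\hat y)\Big(\partial_3L_\Delta[\hat y](t)-\int_a^t\partial_2L_\Delta[\hat y](\tau)\Delta\tau\Big)+\mathcal J_\Delta(\hat y)\Big(\partial_3L_\nabla\{\hat y\}(\sigma(t))-\int_a^{\sigma(t)}\partial_2L_\nabla\{\hat y\}(\tau)\nabla\tau\Big)=\mathrm{const}\quad\forall t\in[a,b]^\kappa \tag{EL2}$$ holds if and only if the integral delta Euler–Lagrange equation $$\partial_3L_\Delta[\hat y](t)-\int_a^t\partial_2L_\Delta[\hat y](\tau)\,\Delta\tau=\mathrm{const}\quad\forall t\in[a,b]^\kappa \tag{1}$$ holds; and if moreover $\hat y$ is a weak local extremizer of $\mathcal J$, then (1) holds. 3. In particular, if $L_\nabla\equiv\frac1{b-a}$, then $\mathcal J_\nabla(y)=1$ and $\mathcal J(y)=\mathcal J_\Delta(y)$ for all $y\in C^1_\diamond$, and every weak local extremizer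 of $\mathcal J_\Delta$ satisfies (1). -/

import Mathlib

open scoped ENNReal

noncomputable section

namespace TimeScale

/-- Forward jump operator of the time scale `T`: `inf {s ∈ T : s > t}`, with `σ(t) = t` if `t` has
no point of `T` to its right (that is, `t = max T`). -/
def sigma (T : Set ℝ) (t : ℝ) : ℝ :=
  open Classical in if (T ∩ Set.Ioi t).Nonempty then sInf (T ∩ Set.Ioi t) else t

/-- Backward jump operator of the time scale `T`: `sup {s ∈ T : s < t}`, with `ρ(t) = t` if `t` has
no point of `T` to its left (that is, `t = min T`). -/
def rho (T : Set ℝ) (t : ℝ) : ℝ :=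
  open Classical in if (T ∩ Set.Iio t).Nonempty then sSup (T ∩ Set.Iio t) else t

/-- `T^κ`: the time scale `T` without its maximum, if that exists and is left-scattered. -/
def kappaUpper (T : Set ℝ) : Set ℝ := {t ∈ T | ¬ (IsGreatest T t ∧ rho T t < t)}

/-- `T_κ`: the time scale `T` without its minimum, if that exists and is right-scattered. -/
def kappaLower (T : Set ℝ) : Set ℝ := {t ∈ T | ¬ (IsLeast T t ∧ t < sigma T t)}

/-- `d` is a delta (Hilger) derivative at `t` of the function `f` on the time scale `T`. -/
def HasDeltaDerivAt (T : Set ℝ) (f : ℝ → ℝ) (d t : ℝ) : Prop :=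
  ∀ ε > 0, ∃ δ > 0, ∀ s ∈ T, |s - t| < δ →
    |f (sigma T t) - f s - d * (sigma T t - s)| ≤ ε * |sigma T t - s|

/-- `d` is a nabla derivative at `t` of the function `f` on the time scale `T`. -/
def HasNablaDerivAt (T : Set ℝ) (f : ℝ → ℝ) (d t : ℝ) : Prop :=
  ∀ ε > 0, ∃ δ > 0, ∀ s ∈ T, |s - t| < δ →
    |f (rho T t) - f s - d * (rho T t - s)| ≤ ε * |rho T t - s|

/-- The delta derivative `f^Δ(t)` (it is unique for `t ∈ T^κ`; `0` if it does not exist). -/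
def deltaDeriv (T : Set ℝ) (f : ℝ → ℝ) (t : ℝ) : ℝ :=
  open Classical in if h : ∃ d, HasDeltaDerivAt T f d t then h.choose else 0

/-- The nabla derivative `f^∇(t)` (it is unique for `t ∈ T_κ`; `0` if it does not exist). -/
def nablaDeriv (T : Set ℝ) (f : ℝ → ℝ) (t : ℝ) : ℝ :=
  open Classical in if h : ∃ d, HasNablaDerivAt T f d t then h.choose else 0

/-- `F` is a delta antiderivative of `f` on `T`: `F^Δ = f` on `T^κ`. -/
def IsDeltaAntideriv (T : Set ℝ) (F f : ℝ → ℝ) : Prop :=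
  ∀ t ∈ kappaUpper T, HasDeltaDerivAt T F (f t) t

/-- `F` is a nabla antiderivative of `f` on `T`: `F^∇ = f` on `T_κ`. -/
def IsNablaAntideriv (T : Set ℝ) (F f : ℝ → ℝ) : Prop :=
  ∀ t ∈ kappaLower T, HasNablaDerivAt T F (f t) t

/-- The (Cauchy) delta integral `∫_r^s f(t) Δt = F(s) - F(r)`, for `r, s ∈ T` and `F` a delta
antiderivative of `f`; antiderivatives differ by constants, and every rd-continuous `f` has one.
(It is `0` if there is none.) -/
def deltaIntegral (T : Set ℝ) (f : ℝ → ℝ) (r s : ℝ) : ℝ :=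
  open Classical in
  if h : ∃ F, IsDeltaAntideriv T F f then h.choose s - h.choose r else 0

/-- The (Cauchy) nabla integral `∫_r^s f(t) ∇t = F(s) - F(r)`, for `r, s ∈ T` and `F` a nabla
antiderivative of `f`; antiderivatives differ by constants, and every ld-continuous `f` has one.
(It is `0` if there is none.) -/
def nablaIntegral (T : Set ℝ) (f : ℝ → ℝ) (r s : ℝ) : ℝ :=
  open Classical in
  if h : ∃ F, IsNablaAntideriv T F f then h.choose s - h.choose r else 0

/-- The class `C_⋄^1` of functions on the time scale `T`: `y^Δ` exists and is continuous on `T^κ`,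
and `y^∇` exists and is continuous on `T_κ`. Only the values of `y` on `T` matter. -/
structure IsC1Diamond (T : Set ℝ) (y : ℝ → ℝ) : Prop where
  delta_differentiable : ∀ t ∈ kappaUpper T, ∃ d, HasDeltaDerivAt T y d t
  delta_continuous : ContinuousOn (deltaDeriv T y) (kappaUpper T)
  nabla_differentiable : ∀ t ∈ kappaLower T, ∃ d, HasNablaDerivAt T y d t
  nabla_continuous : ContinuousOn (nablaDeriv T y) (kappaLower T)

/-- The supremum norm over `T^κ_κ = T^κ ∩ T_κ`, with values in `[0, ∞]`. -/
def supNorm (T : Set ℝ) (f : ℝ → ℝ) : ℝ≥0∞ :=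
  ⨆ t ∈ kappaUpper T ∩ kappaLower T, ‖f t‖ₑ

/-- The norm `‖y‖_{1,∞} = ‖y^σ‖_∞ + ‖y^ρ‖_∞ + ‖y^Δ‖_∞ + ‖y^∇‖_∞`. -/
def norm1Inf (T : Set ℝ) (y : ℝ → ℝ) : ℝ≥0∞ :=
  supNorm T (fun t => y (sigma T t)) + supNorm T (fun t => y (rho T t))
    + supNorm T (deltaDeriv T y) + supNorm T (nablaDeriv T y)

/-- The partial derivative `∂₂L` with respect to the second variable. -/
def partial2 (L : ℝ → ℝ → ℝ → ℝ) (t u v : ℝ) : ℝ := deriv (fun x => L t x v) u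

/-- The partial derivative `∂₃L` with respect to the third variable. -/
def partial3 (L : ℝ → ℝ → ℝ → ℝ) (t u v : ℝ) : ℝ := deriv (fun x => L t u x) v

/-- The smoothness required of a Lagrangian `L : T × ℝ² → ℝ`: it is continuous, and the partial
derivatives `∂₂L`, `∂₃L` exist and are continuous on `T × ℝ²`. -/
structure IsSmoothLagrangian (T : Set ℝ) (L : ℝ → ℝ → ℝ → ℝ) : Prop where
  continuous : ContinuousOn (fun p : ℝ × ℝ × ℝ => L p.1 p.2.1 p.2.2) (T ×ˢ Set.univ)
  differentiable2 : ∀ t ∈ T, ∀ u v : ℝ, DifferentiableAt ℝ (fun x => L t x v) u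
  differentiable3 : ∀ t ∈ T, ∀ u v : ℝ, DifferentiableAt ℝ (fun x => L t u x) v
  continuous2 :
    ContinuousOn (fun p : ℝ × ℝ × ℝ => partial2 L p.1 p.2.1 p.2.2) (T ×ˢ Set.univ)
  continuous3 :
    ContinuousOn (fun p : ℝ × ℝ × ℝ => partial3 L p.1 p.2.1 p.2.2) (T ×ˢ Set.univ)

/-- `G[y](t) = G(t, y^σ(t), y^Δ(t))`. -/
def alongDelta (T : Set ℝ) (G : ℝ → ℝ → ℝ → ℝ) (y : ℝ → ℝ) (t : ℝ) : ℝ :=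
  G t (y (sigma T t)) (deltaDeriv T y t)

/-- `G{y}(t) = G(t, y^ρ(t), y^∇(t))`. -/
def alongNabla (T : Set ℝ) (G : ℝ → ℝ → ℝ → ℝ) (y : ℝ → ℝ) (t : ℝ) : ℝ :=
  G t (y (rho T t)) (nablaDeriv T y t)

/-- `J_Δ(y) = ∫_a^b L_Δ[y](t) Δt`. -/
def deltaFunctional (T : Set ℝ) (a b : ℝ) (L : ℝ → ℝ → ℝ → ℝ) (y : ℝ → ℝ) : ℝ :=
  deltaIntegral T (alongDelta T L y) a b

/-- `J_∇(y) = ∫_a^b L_∇{y}(t) ∇t`. -/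
def nablaFunctional (T : Set ℝ) (a b : ℝ) (L : ℝ → ℝ → ℝ → ℝ) (y : ℝ → ℝ) : ℝ :=
  nablaIntegral T (alongNabla T L y) a b

/-- The delta-nabla functional `J(y) = J_Δ(y) J_∇(y)`. -/
def deltaNablaFunctional (T : Set ℝ) (a b : ℝ) (LΔ LN : ℝ → ℝ → ℝ → ℝ) (y : ℝ → ℝ) : ℝ :=
  deltaFunctional T a b LΔ y * nablaFunctional T a b LN y

/-- `y` is admissible: it is of class `C_⋄^1`, with `y(a) = α` and `y(b) = β`. -/
def IsAdmissible (T : Set ℝ) (a b α β : ℝ) (y : ℝ → ℝ) : Prop :=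
  IsC1Diamond T y ∧ y a = α ∧ y b = β

/-- `ŷ` is a weak local minimizer of `J` among the admissible functions. -/
def IsWeakLocalMinimizer (T : Set ℝ) (a b α β : ℝ) (J : (ℝ → ℝ) → ℝ) (ŷ : ℝ → ℝ) : Prop :=
  IsAdmissible T a b α β ŷ ∧ ∃ δ : ℝ, 0 < δ ∧ ∀ y : ℝ → ℝ, IsAdmissible T a b α β y →
    norm1Inf T (fun t => y t - ŷ t) < ENNReal.ofReal δ → J ŷ ≤ J y

/-- `ŷ` is a weak local maximizer of `J` among the admissible functions. -/
def IsWeakLocalMaximizer (T : Set ℝ) (a b α β : ℝ) (J : (ℝ → ℝ) → ℝ) (ŷ : ℝ → ℝ) : Prop :=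
  IsAdmissible T a b α β ŷ ∧ ∃ δ : ℝ, 0 < δ ∧ ∀ y : ℝ → ℝ, IsAdmissible T a b α β y →
    norm1Inf T (fun t => y t - ŷ t) < ENNReal.ofReal δ → J y ≤ J ŷ

/-- `ŷ` is a weak local extremizer of `J` among the admissible functions. -/
def IsWeakLocalExtremizer (T : Set ℝ) (a b α β : ℝ) (J : (ℝ → ℝ) → ℝ) (ŷ : ℝ → ℝ) : Prop :=
  IsWeakLocalMinimizer T a b α β J ŷ ∨ IsWeakLocalMaximizer T a b α β J ŷ

/-- The left-hand side `∂₃L_Δ[y](t) - ∫_a^t ∂₂L_Δ[y](τ) Δτ` of the integral delta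
Euler–Lagrange equation. -/
def deltaEL (T : Set ℝ) (a : ℝ) (L : ℝ → ℝ → ℝ → ℝ) (y : ℝ → ℝ) (t : ℝ) : ℝ :=
  alongDelta T (partial3 L) y t - deltaIntegral T (alongDelta T (partial2 L) y) a t

/-- The left-hand side `∂₃L_∇{y}(t) - ∫_a^t ∂₂L_∇{y}(τ) ∇τ` of the integral nabla
Euler–Lagrange equation. -/
def nablaEL (T : Set ℝ) (a : ℝ) (L : ℝ → ℝ → ℝ → ℝ) (y : ℝ → ℝ) (t : ℝ) : ℝ :=
  alongNabla T (partial3 L) y t - nablaIntegral T (alongNabla T (partial2 L) y) a t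

/-- The integral delta Euler–Lagrange equation:
`∂₃L_Δ[y](t) - ∫_a^t ∂₂L_Δ[y](τ) Δτ = const` for all `t ∈ T^κ`. -/
def SatisfiesDeltaEL (T : Set ℝ) (a : ℝ) (LΔ : ℝ → ℝ → ℝ → ℝ) (y : ℝ → ℝ) : Prop :=
  ∃ c : ℝ, ∀ t ∈ kappaUpper T, deltaEL T a LΔ y t = c

/-- The second delta-nabla integral Euler–Lagrange equation:
`J_∇(y) (∂₃L_Δ[y](t) - ∫_a^t ∂₂L_Δ[y](τ) Δτ)
  + J_Δ(y) (∂₃L_∇{y}(σ(t)) - ∫_a^{σ(t)} ∂₂L_∇{y}(τ) ∇τ) = const` for all `t ∈ T^κ`. -/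
def SatisfiesEL2 (T : Set ℝ) (a b : ℝ) (LΔ LN : ℝ → ℝ → ℝ → ℝ) (y : ℝ → ℝ) : Prop :=
  ∃ c : ℝ, ∀ t ∈ kappaUpper T,
    nablaFunctional T a b LN y * deltaEL T a LΔ y t
      + deltaFunctional T a b LΔ y * nablaEL T a LN y (sigma T t) = c

/-- The time scale interval `[a, b] = {t ∈ T : a ≤ t ≤ b}`, itself regarded as a time scale. -/
def interval (T : Set ℝ) (a b : ℝ) : Set ℝ := T ∩ Set.Icc a b

end TimeScale

end

/-! If `LN` ignores its last two arguments, then J_∇ takes one and the same value C on all functions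
and the nabla bracket of (EL2) vanishes. Hence (EL2) is C times (1), and J = C · J_Δ. For C ≠ 0 a
weak local extremizer of J is one of J_Δ, with minima and maxima exchanged when C < 0. Everything
rests on the Euler–Lagrange theorem for J_Δ in the class C_⋄^1, `IsTimeInterval.satisfiesDeltaEL`.

Its analytic tool is the identity ∫_u^v f Δt = ∫_u^v f(r(x)) dx, where r = `lastPoint` sends x to
the last point of the time scale up to x (`deltaIntegral_eq`). It holds because the right-hand side
is a delta antiderivative and two antiderivatives differ by a constant
(`eq_of_hasDeltaDerivAt_zero`). Differentiation under the integral and integrability then come from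
Lebesgue theory, and integration by parts from the product rule.

The obstacle is the class of variations. The function z(t) = ∫_a^t η Δτ has z^Δ = η and z^∇ = η ∘ ρ,
and the latter is continuous at a left-scattered, right-dense t < b only if η(ρ(t)) = η(t). Only
such η are admitted (`IsTestFunction`), and the lemma of du Bois-Reymond (`exists_eq_const`) has to
be proved with this smaller supply. It suffices: a construction in the style of Urysohn or of the
Cantor function (`exists_testFunction_step`) gives plateaus over the gaps at right-scattered points,
tent functions handle interior points of S, and the remaining points are limits of these two kinds.
-/

namespace TimeScale

open Set Filter Topology MeasureTheory

/-! ### Compact time intervals -/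

/-- `S` is a compact time scale with least element `a` and greatest element `b`, where `a < b`. -/
structure IsTimeInterval (S : Set ℝ) (a b : ℝ) : Prop where
  closed : IsClosed S
  left_mem : a ∈ S
  right_mem : b ∈ S
  subset : S ⊆ Icc a b
  lt : a < b

lemma isTimeInterval_interval {T : Set ℝ} {a b : ℝ} (hT : IsClosed T) (ha : a ∈ T) (hb : b ∈ T)
    (hab : a < b) : IsTimeInterval (interval T a b) a b where
  closed := hT.inter isClosed_Icc
  left_mem := ⟨ha, left_mem_Icc.2 hab.le⟩
  right_mem := ⟨hb, right_mem_Icc.2 hab.le⟩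
  subset := inter_subset_right
  lt := hab

/-- The largest point of `S` that is at most `x` (and the least point `a` of `S` if `x < a`). -/
noncomputable def lastPoint (S : Set ℝ) (a x : ℝ) : ℝ := sSup (S ∩ Iic (max a x))

namespace IsTimeInterval

variable {S : Set ℝ} {a b : ℝ}

lemma isCompact (h : IsTimeInterval S a b) : IsCompact S :=
  isCompact_Icc.of_isClosed_subset h.closed h.subset

/-! ### The jump operators -/

lemma sigma_right (h : IsTimeInterval S a b) : sigma S b = b := by
  rw [sigma, if_neg]
  rintro ⟨x, hx, hx'⟩
  exact absurd (h.subset hx).2 (not_le.2 hx')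

lemma sigma_eq (h : IsTimeInterval S a b) {t : ℝ} (ht : t < b) :
    sigma S t = sInf (S ∩ Ioi t) := if_pos ⟨b, h.right_mem, ht⟩

lemma sigma_le (h : IsTimeInterval S a b) {t s : ℝ} (hs : s ∈ S) (hts : t < s) :
    sigma S t ≤ s := by
  rw [h.sigma_eq (hts.trans_le (h.subset hs).2)]
  exact csInf_le ⟨t, fun x hx => hx.2.le⟩ ⟨hs, hts⟩

lemma le_sigma (h : IsTimeInterval S a b) {t : ℝ} (ht : t ∈ S) : t ≤ sigma S t := by
  rcases (h.subset ht).2.lt_or_eq with hb | rfl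
  · rw [h.sigma_eq hb]
    exact le_csInf ⟨b, h.right_mem, hb⟩ fun x hx => hx.2.le
  · rw [h.sigma_right]

lemma sigma_mem (h : IsTimeInterval S a b) {t : ℝ} (ht : t ∈ S) : sigma S t ∈ S := by
  rcases (h.subset ht).2.lt_or_eq with hb | rfl
  · rw [h.sigma_eq hb]
    have : sInf (S ∩ Ioi t) ∈ closure (S ∩ Ioi t) := csInf_mem_closure
      ⟨b, h.right_mem, hb⟩ ⟨t, fun x hx => hx.2.le⟩
    exact closure_minimal inter_subset_left h.closed this
  · rwa [h.sigma_right]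

lemma exists_gt_lt (h : IsTimeInterval S a b) {t y : ℝ} (hb : t < b) (hy : sigma S t < y) :
    ∃ s ∈ S, t < s ∧ s < y := by
  rw [h.sigma_eq hb] at hy
  obtain ⟨s, ⟨hs, hs'⟩, hlt⟩ := exists_lt_of_csInf_lt (s := S ∩ Ioi t)
    (show (S ∩ Ioi t).Nonempty from ⟨b, h.right_mem, hb⟩) hy
  exact ⟨s, hs, hs', hlt⟩

lemma rho_left (h : IsTimeInterval S a b) : rho S a = a := by
  rw [rho, if_neg]
  rintro ⟨x, hx, hx'⟩
  exact absurd (h.subset hx).1 (not_le.2 hx')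

lemma rho_eq (h : IsTimeInterval S a b) {t : ℝ} (ht : a < t) :
    rho S t = sSup (S ∩ Iio t) := if_pos ⟨a, h.left_mem, ht⟩

lemma le_rho (h : IsTimeInterval S a b) {t s : ℝ} (hs : s ∈ S) (hts : s < t) :
    s ≤ rho S t := by
  rw [h.rho_eq ((h.subset hs).1.trans_lt hts)]
  exact le_csSup ⟨t, fun x hx => hx.2.le⟩ ⟨hs, hts⟩

lemma rho_le (h : IsTimeInterval S a b) {t : ℝ} (ht : t ∈ S) : rho S t ≤ t := by
  rcases (h.subset ht).1.lt_or_eq with hb | rfl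
  · rw [h.rho_eq hb]
    exact csSup_le ⟨a, h.left_mem, hb⟩ fun x hx => hx.2.le
  · rw [h.rho_left]

lemma rho_mem (h : IsTimeInterval S a b) {t : ℝ} (ht : t ∈ S) : rho S t ∈ S := by
  rcases (h.subset ht).1.lt_or_eq with hb | rfl
  · rw [h.rho_eq hb]
    have : sSup (S ∩ Iio t) ∈ closure (S ∩ Iio t) := csSup_mem_closure
      ⟨a, h.left_mem, hb⟩ ⟨t, fun x hx => hx.2.le⟩
    exact closure_minimal inter_subset_left h.closed this
  · rwa [h.rho_left]

lemma exists_lt_gt (h : IsTimeInterval S a b) {t y : ℝ} (hb : a < t) (hy : y < rho S t) :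
    ∃ s ∈ S, s < t ∧ y < s := by
  rw [h.rho_eq hb] at hy
  obtain ⟨s, ⟨hs, hs'⟩, hlt⟩ := exists_lt_of_lt_csSup (s := S ∩ Iio t)
    (show (S ∩ Iio t).Nonempty from ⟨a, h.left_mem, hb⟩) hy
  exact ⟨s, hs, hs', hlt⟩

lemma isGreatest (h : IsTimeInterval S a b) : IsGreatest S b :=
  ⟨h.right_mem, fun _ hx => (h.subset hx).2⟩

lemma isLeast (h : IsTimeInterval S a b) : IsLeast S a :=
  ⟨h.left_mem, fun _ hx => (h.subset hx).1⟩

lemma mem_kappaUpper_of_lt (h : IsTimeInterval S a b) {t : ℝ} (ht : t ∈ S) (hb : t < b) :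
    t ∈ kappaUpper S := ⟨ht, fun hg => hb.ne (hg.1.unique h.isGreatest)⟩

lemma mem_kappaUpper_iff (h : IsTimeInterval S a b) {t : ℝ} :
    t ∈ kappaUpper S ↔ t ∈ S ∧ (t < b ∨ t = b ∧ rho S b = b) := by
  constructor
  · rintro ⟨ht, hn⟩
    refine ⟨ht, (h.subset ht).2.lt_or_eq.imp_right ?_⟩
    rintro rfl
    exact ⟨rfl, le_antisymm (h.rho_le ht) (not_lt.1 fun hlt => hn ⟨h.isGreatest, hlt⟩)⟩
  · rintro ⟨ht, hb | ⟨rfl, hb⟩⟩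
    · exact h.mem_kappaUpper_of_lt ht hb
    · exact ⟨ht, fun hn => hn.2.ne hb⟩

lemma mem_kappaLower_iff (h : IsTimeInterval S a b) {t : ℝ} :
    t ∈ kappaLower S ↔ t ∈ S ∧ (a < t ∨ t = a ∧ sigma S a = a) := by
  constructor
  · rintro ⟨ht, hn⟩
    refine ⟨ht, (h.subset ht).1.lt_or_eq.imp_right ?_⟩
    rintro rfl
    exact ⟨rfl, le_antisymm (not_lt.1 fun hlt => hn ⟨h.isLeast, hlt⟩) (h.le_sigma ht)⟩
  · rintro ⟨ht, hb | ⟨rfl, hb⟩⟩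
    · exact ⟨ht, fun hg => hb.ne (h.isLeast.unique hg.1)⟩
    · exact ⟨ht, fun hn => hn.2.ne' hb⟩

/-- A point of `S^κ` is a limit of points of `S` unless it is right-scattered. -/
lemma exists_near (h : IsTimeInterval S a b) {t : ℝ} (ht : t ∈ kappaUpper S)
    (hσ : sigma S t = t) {δ : ℝ} (hδ : 0 < δ) : ∃ s ∈ S, s ≠ t ∧ |s - t| < δ := by
  obtain ⟨-, hb | ⟨rfl, hb⟩⟩ := h.mem_kappaUpper_iff.1 ht
  · obtain ⟨s, hs, h1, h2⟩ := h.exists_gt_lt hb (y := t + δ) (by linarith)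
    exact ⟨s, hs, h1.ne', abs_lt.2 ⟨by linarith, by linarith⟩⟩
  · obtain ⟨s, hs, h1, h2⟩ := h.exists_lt_gt h.lt (y := t - δ) (by linarith)
    exact ⟨s, hs, h1.ne, abs_lt.2 ⟨by linarith, by linarith⟩⟩

/-! ### The last point -/

lemma lastPoint_mem (h : IsTimeInterval S a b) (x : ℝ) : lastPoint S a x ∈ S := by
  have : lastPoint S a x ∈ closure (S ∩ Iic (max a x)) := csSup_mem_closure
    ⟨a, h.left_mem, mem_Iic.2 (le_max_left _ _)⟩
    ⟨max a x, fun x hx => hx.2⟩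
  exact closure_minimal inter_subset_left h.closed this

lemma lastPoint_le_max (h : IsTimeInterval S a b) (x : ℝ) : lastPoint S a x ≤ max a x :=
  csSup_le ⟨a, h.left_mem, mem_Iic.2 (le_max_left _ _)⟩ fun _ hx => hx.2

lemma lastPoint_le (h : IsTimeInterval S a b) {x : ℝ} (hx : a ≤ x) : lastPoint S a x ≤ x :=
  (h.lastPoint_le_max x).trans_eq (max_eq_right hx)

lemma le_lastPoint {s x : ℝ} (hs : s ∈ S) (hsx : s ≤ x) : s ≤ lastPoint S a x :=
  le_csSup ⟨max a x, fun _ hx => hx.2⟩ ⟨hs, hsx.trans (le_max_right _ _)⟩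

lemma lastPoint_of_mem (h : IsTimeInterval S a b) {s : ℝ} (hs : s ∈ S) : lastPoint S a s = s :=
  le_antisymm (h.lastPoint_le (h.subset hs).1) (le_lastPoint hs le_rfl)

lemma lastPoint_of_le (h : IsTimeInterval S a b) {x : ℝ} (hx : x ≤ a) : lastPoint S a x = a :=
  le_antisymm ((h.lastPoint_le_max x).trans_eq (max_eq_left hx)) (h.subset (h.lastPoint_mem x)).1

lemma lastPoint_eq_of_lt_sigma (h : IsTimeInterval S a b) {t x : ℝ} (ht : t ∈ S) (htx : t ≤ x)
    (hx : x < sigma S t) : lastPoint S a x = t := by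
  refine le_antisymm (not_lt.1 fun hlt => ?_) (le_lastPoint ht htx)
  have := h.sigma_le (h.lastPoint_mem x) hlt
  have := h.lastPoint_le ((h.subset ht).1.trans htx)
  linarith

/-- A point x outside S lies in a gap, and that gap starts at the last point. If that point were
right-dense, S would have further points between it and x. -/
lemma lt_sigma_lastPoint (h : IsTimeInterval S a b) {x : ℝ} (hx : x < b)
    (hne : lastPoint S a x < x) : x < sigma S (lastPoint S a x) := by
  by_contra! hcon
  have := le_lastPoint (a := a) (h.sigma_mem (h.lastPoint_mem x)) hcon
  have h2 := le_antisymm this (h.le_sigma (h.lastPoint_mem x))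
  obtain ⟨s, hs, h3, h4⟩ := h.exists_gt_lt (hne.trans hx) (h2.trans_lt hne)
  exact absurd (le_lastPoint (a := a) hs h4.le) (not_le.2 h3)

/-- Either the last point is constant to the right of `x`, or `x` is a right-dense point. -/
lemma eventually_lastPoint_eq_or (h : IsTimeInterval S a b) (x : ℝ) :
    (∀ᶠ z in 𝓝[≥] x, lastPoint S a z = lastPoint S a x) ∨
      (x ∈ S ∧ x < b ∧ sigma S x = x) := by
  rcases lt_or_ge x a with hxa | hax
  · left
    filter_upwards [mem_nhdsWithin_of_mem_nhds (Iio_mem_nhds hxa)] with z hz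
    rw [h.lastPoint_of_le hz.le, h.lastPoint_of_le hxa.le]
  rcases le_or_gt b x with hbx | hxb
  · left
    filter_upwards [self_mem_nhdsWithin] with z hz
    have key : ∀ w, b ≤ w → lastPoint S a w = b := fun w hw =>
      le_antisymm (h.subset (h.lastPoint_mem w)).2 (le_lastPoint h.right_mem hw)
    rw [key z (hbx.trans hz), key x hbx]
  by_cases hσ : x < sigma S (lastPoint S a x)
  · left
    filter_upwards [self_mem_nhdsWithin, mem_nhdsWithin_of_mem_nhds (Iio_mem_nhds hσ)] with z hz hz'
    exact h.lastPoint_eq_of_lt_sigma (h.lastPoint_mem x) ((h.lastPoint_le hax).trans hz) hz'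
  · right
    have he : lastPoint S a x = x :=
      (h.lastPoint_le hax).eq_or_lt.resolve_right fun hne => hσ (h.lt_sigma_lastPoint hxb hne)
    have hxS : x ∈ S := he ▸ h.lastPoint_mem x
    rw [he] at hσ
    exact ⟨hxS, hxb, le_antisymm (not_lt.1 hσ) (h.le_sigma hxS)⟩

end IsTimeInterval

/-! ### Measurability and rd-bounded functions -/

/-- A real function with right limits equal to its values is measurable. -/
lemma measurable_of_continuousWithinAt_Ioi {g : ℝ → ℝ}
    (hg : ∀ x, ContinuousWithinAt g (Ioi x) x) : Measurable g := by
  -- The sampling points lie strictly to the right of x and within 1/(n+1) of it. So `g` is the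
  -- pointwise limit of functions that factor through a floor, which are measurable.
  have key : ∀ x : ℝ, Tendsto (fun n : ℕ => ((⌊((n : ℝ) + 1) * x⌋ : ℝ) + 1) / ((n : ℝ) + 1)) atTop
      (𝓝[>] x) := by
    intro x
    have hpos : ∀ n : ℕ, (0 : ℝ) < n + 1 := fun n => by positivity
    refine tendsto_nhdsWithin_iff.2 ⟨?_, Eventually.of_forall fun n => ?_⟩
    · have h1 : Tendsto (fun n : ℕ => x + 1 / ((n : ℝ) + 1)) atTop (𝓝 x) := by
        simpa using tendsto_const_nhds.add (tendsto_one_div_add_atTop_nhds_zero_nat (𝕜 := ℝ))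
      refine tendsto_of_tendsto_of_tendsto_of_le_of_le tendsto_const_nhds h1 (fun n => ?_)
        fun n => ?_
      · have := Int.lt_floor_add_one (((n : ℝ) + 1) * x)
        rw [le_div_iff₀ (hpos n)]
        linarith
      · have := Int.floor_le (((n : ℝ) + 1) * x)
        have h0 := (hpos n).ne'
        rw [div_le_iff₀ (hpos n)]
        field_simp
        linarith
    · have := Int.lt_floor_add_one (((n : ℝ) + 1) * x)
      rw [mem_Ioi, lt_div_iff₀ (hpos n)]
      linarith
  refine measurable_of_tendsto_metrizable
    (f := fun n : ℕ => fun x => g (((⌊((n : ℝ) + 1) * x⌋ : ℝ) + 1) / ((n : ℝ) + 1)))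
    (fun n => ?_) (tendsto_pi_nhds.2 fun x => (hg x).tendsto.comp (key x))
  exact (measurable_from_top (f := fun k : ℤ => g (((k : ℝ) + 1) / ((n : ℝ) + 1)))).comp
    (Int.measurable_floor.comp (measurable_const.mul measurable_id))

/-- `f` is bounded on `S` and continuous at the right-dense points of `S`. -/
structure IsRdBounded (S : Set ℝ) (f : ℝ → ℝ) : Prop where
  bounded : ∃ M, ∀ t ∈ S, |f t| ≤ M
  continuousWithinAt : ∀ t ∈ S, sigma S t = t → ContinuousWithinAt f S t

lemma _root_.ContinuousOn.isRdBounded {S : Set ℝ} (hS : IsCompact S) {f : ℝ → ℝ}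
    (hf : ContinuousOn f S) : IsRdBounded S f where
  bounded := by
    obtain ⟨M, hM⟩ := hS.exists_bound_of_continuousOn hf
    exact ⟨M, hM⟩
  continuousWithinAt t ht _ := hf t ht

namespace IsRdBounded

variable {S : Set ℝ} {a b : ℝ} {f g : ℝ → ℝ}

lemma mul (hf : IsRdBounded S f) (hg : IsRdBounded S g) : IsRdBounded S (fun t => f t * g t) where
  bounded := by
    obtain ⟨M, hM⟩ := hf.bounded
    obtain ⟨N, hN⟩ := hg.bounded
    refine ⟨M * N, fun t ht => ?_⟩
    rw [abs_mul]
    exact mul_le_mul (hM t ht) (hN t ht) (abs_nonneg _) ((abs_nonneg _).trans (hM t ht))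
  continuousWithinAt t ht hσ := (hf.continuousWithinAt t ht hσ).mul (hg.continuousWithinAt t ht hσ)

lemma add (hf : IsRdBounded S f) (hg : IsRdBounded S g) : IsRdBounded S (fun t => f t + g t) where
  bounded := by
    obtain ⟨M, hM⟩ := hf.bounded
    obtain ⟨N, hN⟩ := hg.bounded
    exact ⟨M + N, fun t ht => (abs_add_le _ _).trans (add_le_add (hM t ht) (hN t ht))⟩
  continuousWithinAt t ht hσ := (hf.continuousWithinAt t ht hσ).add (hg.continuousWithinAt t ht hσ)

lemma const (c : ℝ) : IsRdBounded S (fun _ => c) where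
  bounded := ⟨|c|, fun _ _ => le_rfl⟩
  continuousWithinAt _ _ _ := continuousWithinAt_const

lemma sub (hf : IsRdBounded S f) (hg : IsRdBounded S g) : IsRdBounded S (fun t => f t - g t) := by
  simpa [sub_eq_add_neg] using hf.add ((const (-1)).mul hg)

/-- Off the right-dense points the last point is locally constant to the right. At a right-dense
point it is squeezed between x and z, and continuity of `f` within S applies. -/
lemma continuousWithinAt_comp_lastPoint (hf : IsRdBounded S f) (h : IsTimeInterval S a b) (x : ℝ) :
    ContinuousWithinAt (fun x => f (lastPoint S a x)) (Ici x) x := by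
  rcases h.eventually_lastPoint_eq_or x with hx | ⟨hxS, -, hσ⟩
  · refine (tendsto_const_nhds (x := f (lastPoint S a x))).congr' ?_
    filter_upwards [hx] with z hz
    rw [hz]
  · have h1 := h.lastPoint_of_mem hxS
    refine Tendsto.comp (g := f) (y := 𝓝[S] x) ?_ ?_
    · have := (hf.continuousWithinAt x hxS hσ).tendsto
      simpa only [h1] using this
    · refine tendsto_nhdsWithin_iff.2 ⟨?_, Eventually.of_forall h.lastPoint_mem⟩
      refine tendsto_of_tendsto_of_tendsto_of_le_of_le' tendsto_const_nhds
        (tendsto_nhdsWithin_of_tendsto_nhds tendsto_id) ?_ ?_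
      · filter_upwards [self_mem_nhdsWithin] with z hz
        exact IsTimeInterval.le_lastPoint hxS hz
      · filter_upwards [self_mem_nhdsWithin] with z hz
        exact h.lastPoint_le ((h.subset hxS).1.trans hz)

lemma measurable_comp_lastPoint (hf : IsRdBounded S f) (h : IsTimeInterval S a b) :
    Measurable (fun x => f (lastPoint S a x)) :=
  measurable_of_continuousWithinAt_Ioi fun x =>
    (hf.continuousWithinAt_comp_lastPoint h x).mono Ioi_subset_Ici_self

lemma intervalIntegrable (hf : IsRdBounded S f) (h : IsTimeInterval S a b) (u v : ℝ) :
    IntervalIntegrable (fun x => f (lastPoint S a x)) volume u v := by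
  obtain ⟨M, hM⟩ := hf.bounded
  refine (intervalIntegrable_const (c := M)).mono_fun
    (hf.measurable_comp_lastPoint h).aestronglyMeasurable (Eventually.of_forall fun x => ?_)
  exact (hM _ (h.lastPoint_mem x)).trans (le_abs_self M)

end IsRdBounded

section

variable {S : Set ℝ} {a b : ℝ} {f g F G : ℝ → ℝ} {d e t : ℝ}

/-! ### Delta derivatives -/

lemma HasDeltaDerivAt.const_mul (c : ℝ) (hF : HasDeltaDerivAt S F d t) :
    HasDeltaDerivAt S (fun s => c * F s) (c * d) t := by
  intro ε hε
  obtain ⟨δ, hδ, H⟩ := hF (ε / (|c| + 1)) (by positivity)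
  refine ⟨δ, hδ, fun s hs hst => ?_⟩
  have h1 := H s hs hst
  have h2 : c * F (sigma S t) - c * F s - c * d * (sigma S t - s) =
      c * (F (sigma S t) - F s - d * (sigma S t - s)) := by ring
  rw [h2, abs_mul]
  have h3 : |c| * (ε / (|c| + 1) * |sigma S t - s|) ≤ ε * |sigma S t - s| := by
    rw [← mul_assoc]
    refine mul_le_mul_of_nonneg_right ?_ (abs_nonneg _)
    rw [mul_div_assoc', div_le_iff₀ (by positivity)]
    nlinarith [abs_nonneg c]
  exact (mul_le_mul_of_nonneg_left h1 (abs_nonneg c)).trans h3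

lemma HasDeltaDerivAt.add (hF : HasDeltaDerivAt S F d t) (hG : HasDeltaDerivAt S G e t) :
    HasDeltaDerivAt S (fun s => F s + G s) (d + e) t := by
  intro ε hε
  obtain ⟨δ, hδ, H⟩ := hF (ε / 2) (by positivity)
  obtain ⟨δ', hδ', H'⟩ := hG (ε / 2) (by positivity)
  refine ⟨min δ δ', lt_min hδ hδ', fun s hs hst => ?_⟩
  have h1 := H s hs (hst.trans_le (min_le_left _ _))
  have h2 := H' s hs (hst.trans_le (min_le_right _ _))
  have h3 : F (sigma S t) + G (sigma S t) - (F s + G s) - (d + e) * (sigma S t - s) =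
      (F (sigma S t) - F s - d * (sigma S t - s)) +
      (G (sigma S t) - G s - e * (sigma S t - s)) := by ring
  rw [h3]
  refine (abs_add_le _ _).trans ?_
  linarith

lemma HasDeltaDerivAt.continuousWithinAt (hF : HasDeltaDerivAt S F d t) (ht : t ∈ S) :
    ContinuousWithinAt F S t := by
  rw [Metric.continuousWithinAt_iff]
  intro ε hε
  -- F s and F t are both compared with F(σ(t)); for |s - t| < 1 the two distances to σ(t) add up to
  -- at most `K`.
  set K : ℝ := 2 * |sigma S t - t| + 1 with hK
  have hKpos : 0 < K := by positivity
  obtain ⟨δ, hδ, H⟩ := hF (ε / (4 * K)) (by positivity)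
  have hη : 0 < ε / (4 * (|d| + 1)) := by positivity
  refine ⟨min δ (min 1 (ε / (4 * (|d| + 1)))), lt_min hδ (lt_min one_pos hη), fun s hs hst => ?_⟩
  rw [Real.dist_eq] at hst ⊢
  have h1 := H s hs (hst.trans_le (min_le_left _ _))
  have h2 := H t ht (by simpa using hδ)
  have hs1 : |s - t| < 1 := hst.trans_le ((min_le_right _ _).trans (min_le_left _ _))
  have hs2 : |s - t| < ε / (4 * (|d| + 1)) :=
    hst.trans_le ((min_le_right _ _).trans (min_le_right _ _))
  have h4 : |sigma S t - s| + |sigma S t - t| ≤ K := by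
    have : |sigma S t - s| ≤ |sigma S t - t| + |t - s| := abs_sub_le _ _ _
    rw [abs_sub_comm t s] at this
    linarith
  have h5 : |d| * |s - t| ≤ ε / 4 := by
    rw [lt_div_iff₀ (by positivity)] at hs2
    nlinarith [abs_nonneg d, abs_nonneg (s - t)]
  have h6 : F s - F t = (F (sigma S t) - F t - d * (sigma S t - t)) -
      (F (sigma S t) - F s - d * (sigma S t - s)) + d * (s - t) := by ring
  have h7 : ε / (4 * K) * (|sigma S t - s| + |sigma S t - t|) ≤ ε / 4 := by
    refine (mul_le_mul_of_nonneg_left h4 (by positivity)).trans_eq ?_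
    field_simp
  rw [h6]
  refine (abs_add_le _ _).trans_lt ?_
  rw [abs_mul]
  have := abs_sub (F (sigma S t) - F t - d * (sigma S t - t))
    (F (sigma S t) - F s - d * (sigma S t - s))
  linarith

lemma HasDeltaDerivAt.mul (hF : HasDeltaDerivAt S F d t) (hG : HasDeltaDerivAt S G e t)
    (ht : t ∈ S) :
    HasDeltaDerivAt S (fun s => F s * G s) (d * G (sigma S t) + F t * e) t := by
  intro ε hε
  have hc := Metric.continuousWithinAt_iff.1 (hF.continuousWithinAt ht)
  obtain ⟨δ₁, hδ₁, H₁⟩ := hF (ε / (3 * (|G (sigma S t)| + 1))) (by positivity)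
  obtain ⟨δ₂, hδ₂, H₂⟩ := hG (ε / (3 * (|F t| + 1))) (by positivity)
  obtain ⟨δ₃, hδ₃, H₃⟩ := hc (min 1 (ε / (3 * (|e| + 1)))) (lt_min one_pos (by positivity))
  refine ⟨min δ₁ (min δ₂ δ₃), lt_min hδ₁ (lt_min hδ₂ hδ₃), fun s hs hst => ?_⟩
  have h1 := H₁ s hs (hst.trans_le (min_le_left _ _))
  have h2 := H₂ s hs (hst.trans_le ((min_le_right _ _).trans (min_le_left _ _)))
  have h3 := H₃ hs (hst.trans_le ((min_le_right _ _).trans (min_le_right _ _)))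
  rw [Real.dist_eq] at h3
  have h3a : |F s - F t| ≤ 1 := (h3.trans_le (min_le_left _ _)).le
  have h3b : |F s - F t| ≤ ε / (3 * (|e| + 1)) := (h3.trans_le (min_le_right _ _)).le
  have h4 : |F s| ≤ |F t| + 1 := by
    have := abs_add_le (F s - F t) (F t)
    rw [sub_add_cancel] at this
    linarith
  have h5 : F (sigma S t) * G (sigma S t) - F s * G s
      - (d * G (sigma S t) + F t * e) * (sigma S t - s) =
      G (sigma S t) * (F (sigma S t) - F s - d * (sigma S t - s)) +
      F s * (G (sigma S t) - G s - e * (sigma S t - s)) +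
      (F s - F t) * e * (sigma S t - s) := by ring
  rw [h5]
  refine (abs_add_three _ _ _).trans ?_
  simp only [abs_mul]
  have k1 : |G (sigma S t)| * |F (sigma S t) - F s - d * (sigma S t - s)| ≤
      ε / 3 * |sigma S t - s| := by
    refine (mul_le_mul (lt_add_one _).le h1 (abs_nonneg _) (by positivity)).trans_eq ?_
    field_simp
  have k2 : |F s| * |G (sigma S t) - G s - e * (sigma S t - s)| ≤ ε / 3 * |sigma S t - s| := by
    refine (mul_le_mul h4 h2 (abs_nonneg _) (by positivity)).trans_eq ?_
    field_simp
  have k3 : |F s - F t| * |e| * |sigma S t - s| ≤ ε / 3 * |sigma S t - s| := by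
    refine mul_le_mul_of_nonneg_right ?_ (abs_nonneg _)
    refine (mul_le_mul h3b (lt_add_one _).le (abs_nonneg _) (by positivity)).trans_eq ?_
    field_simp
  linarith

lemma IsTimeInterval.hasDeltaDerivAt_unique (h : IsTimeInterval S a b) (ht : t ∈ kappaUpper S)
    (hd : HasDeltaDerivAt S F d t) (he : HasDeltaDerivAt S F e t) : d = e := by
  by_contra hne
  have hpos : 0 < |d - e| := abs_pos.2 (sub_ne_zero.2 hne)
  obtain ⟨δ, hδ, H⟩ := hd (|d - e| / 3) (by positivity)
  obtain ⟨δ', hδ', H'⟩ := he (|d - e| / 3) (by positivity)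
  -- At a right-scattered t the point s = t already determines the derivative. Otherwise membership
  -- in S^κ supplies points s ≠ t arbitrarily near.
  obtain ⟨s, hs, hst, hne⟩ : ∃ s ∈ S, |s - t| < min δ δ' ∧ sigma S t ≠ s := by
    by_cases hσ : sigma S t = t
    · obtain ⟨s, hs, h1, h2⟩ := h.exists_near ht hσ (lt_min hδ hδ')
      exact ⟨s, hs, h2, hσ.trans_ne h1.symm⟩
    · exact ⟨t, ht.1, by simpa using And.intro hδ hδ', hσ⟩
  have h1 := H s hs (hst.trans_le (min_le_left _ _))
  have h2 := H' s hs (hst.trans_le (min_le_right _ _))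
  have h3 : (d - e) * (sigma S t - s) = (F (sigma S t) - F s - e * (sigma S t - s)) -
      (F (sigma S t) - F s - d * (sigma S t - s)) := by ring
  have h4 : |d - e| * |sigma S t - s| ≤ |d - e| / 3 * |sigma S t - s| +
      |d - e| / 3 * |sigma S t - s| := by
    rw [← abs_mul, h3]
    exact (abs_sub _ _).trans (add_le_add h2 h1)
  have h5 : 0 < |sigma S t - s| := abs_pos.2 (sub_ne_zero.2 hne)
  nlinarith [mul_pos hpos h5]

lemma IsTimeInterval.deltaDeriv_eq (h : IsTimeInterval S a b) (ht : t ∈ kappaUpper S)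
    (hd : HasDeltaDerivAt S F d t) : deltaDeriv S F t = d := by
  have hex : ∃ d, HasDeltaDerivAt S F d t := ⟨d, hd⟩
  rw [deltaDeriv, dif_pos hex]
  exact h.hasDeltaDerivAt_unique ht hex.choose_spec hd

lemma hasDeltaDerivAt_deltaDeriv (hex : ∃ d, HasDeltaDerivAt S F d t) :
    HasDeltaDerivAt S F (deltaDeriv S F t) t := by
  rw [deltaDeriv, dif_pos hex]
  exact hex.choose_spec

/-- A function with vanishing delta derivative is constant. -/
lemma IsTimeInterval.eq_of_hasDeltaDerivAt_zero (h : IsTimeInterval S a b)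
    (hF : ∀ t ∈ kappaUpper S, HasDeltaDerivAt S F 0 t) (ht : t ∈ S) : F t = F a := by
  have hFc : ContinuousOn F S := by
    intro s hs
    by_cases hk : s ∈ kappaUpper S
    · exact (hF s hk).continuousWithinAt hs
    · have hsb : s = b := by
        by_contra hne
        exact hk (h.mem_kappaUpper_of_lt hs ((h.subset hs).2.lt_of_ne hne))
      subst hsb
      -- The greatest point is missing from S^κ only when it is left-scattered. It is then isolated
      -- in S, so continuity there is automatic.
      have hρ : rho S s < s := (h.rho_le hs).lt_of_ne fun he =>
        hk (h.mem_kappaUpper_iff.2 ⟨hs, Or.inr ⟨rfl, he⟩⟩)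
      refine continuousWithinAt_const.congr_of_eventuallyEq (f := fun _ => F s) ?_ rfl
      filter_upwards [self_mem_nhdsWithin, mem_nhdsWithin_of_mem_nhds (Ioi_mem_nhds hρ)] with z hz hz'
      rcases (h.subset hz).2.lt_or_eq with hlt | rfl
      · exact absurd (h.le_rho hz hlt) (not_le.2 hz')
      · rfl
  -- Taking s itself in the definition of the derivative bounds the jump by ε(σ(s) - s); the chosen
  -- ε makes this half of the jump.
  have hgap : ∀ s ∈ S, s < b → sigma S s ≠ s → F (sigma S s) = F s := by
    intro s hs hsb hne
    by_contra hFne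
    have hp : 0 < |F (sigma S s) - F s| := abs_pos.2 (sub_ne_zero.2 hFne)
    have hq : 0 < |sigma S s - s| := abs_pos.2 (sub_ne_zero.2 hne)
    obtain ⟨δ, hδ, H⟩ := hF s (h.mem_kappaUpper_of_lt hs hsb)
      (|F (sigma S s) - F s| / (2 * |sigma S s - s|)) (by positivity)
    have := H s hs (by simpa using hδ)
    rw [zero_mul, sub_zero, div_mul_eq_mul_div, le_div_iff₀ (by positivity)] at this
    nlinarith [mul_pos hp hq]
  -- The composite of F with the last point is shown to be continuous on the real interval with
  -- right derivative zero, so the classical constancy theorem applies to it.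
  have hr : ∀ x, HasDerivWithinAt (fun x => F (lastPoint S a x)) 0 (Ici x) x := by
    intro x
    rcases h.eventually_lastPoint_eq_or x with hx | ⟨hxS, hxb, hσ⟩
    · refine (hasDerivWithinAt_const x (Ici x) (F (lastPoint S a x))).congr_of_eventuallyEq ?_ rfl
      filter_upwards [hx] with z hz
      rw [hz]
    · rw [hasDerivWithinAt_iff_isLittleO, Asymptotics.isLittleO_iff]
      intro c hc
      obtain ⟨δ, hδ, H⟩ := hF x (h.mem_kappaUpper_of_lt hxS hxb) c hc
      filter_upwards [self_mem_nhdsWithin,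
        mem_nhdsWithin_of_mem_nhds (Iio_mem_nhds (lt_add_of_pos_right x hδ))] with z hz hz'
      have h1 := h.lastPoint_le ((h.subset hxS).1.trans hz)
      have h2 : x ≤ lastPoint S a z := IsTimeInterval.le_lastPoint hxS hz
      rw [mem_Iio] at hz'
      have h3 := H _ (h.lastPoint_mem z) (abs_lt.2 ⟨by linarith, by linarith⟩)
      rw [hσ, zero_mul, sub_zero] at h3
      rw [h.lastPoint_of_mem hxS, smul_zero, sub_zero, Real.norm_eq_abs, Real.norm_eq_abs,
        abs_sub_comm]
      refine h3.trans (mul_le_mul_of_nonneg_left ?_ hc.le)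
      rw [abs_sub_comm, abs_of_nonneg (sub_nonneg.2 h2), abs_of_nonneg (sub_nonneg.2 hz)]
      linarith
  -- Left continuity: a left-dense point inherits it from F, at the right end of a gap `hgap`
  -- removes the jump, and off S the composite is locally constant.
  have hl : ∀ x ∈ Icc a b, ContinuousWithinAt (fun x => F (lastPoint S a x)) (Iic x) x := by
    intro x hx
    rcases hx.1.lt_or_eq with hax | rfl
    swap
    · refine continuousWithinAt_const.congr_of_eventuallyEq (f := fun _ => F (lastPoint S a a)) ?_ rfl
      filter_upwards [self_mem_nhdsWithin] with z hz
      rw [h.lastPoint_of_le hz, h.lastPoint_of_le le_rfl]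
    by_cases hxS : x ∈ S
    · by_cases hρ : rho S x = x
      · refine Tendsto.comp (g := F) (y := 𝓝[S] x) ?_ ?_
        · simpa only [h.lastPoint_of_mem hxS] using (hFc x hxS).tendsto
        · refine tendsto_nhdsWithin_iff.2 ⟨tendsto_order.2 ⟨fun y hy => ?_, fun y hy => ?_⟩,
            Eventually.of_forall h.lastPoint_mem⟩
          · obtain ⟨s, hs, hsx, hys⟩ := h.exists_lt_gt hax (hy.trans_eq hρ.symm)
            filter_upwards [mem_nhdsWithin_of_mem_nhds (Ioi_mem_nhds hsx)] with z hz
            exact hys.trans_le (IsTimeInterval.le_lastPoint hs (le_of_lt hz))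
          · filter_upwards [self_mem_nhdsWithin,
              mem_nhdsWithin_of_mem_nhds (Ioi_mem_nhds hax)] with z hz hz'
            exact ((h.lastPoint_le (le_of_lt hz')).trans hz).trans_lt hy
      · have hρ' : rho S x < x := (h.rho_le hxS).lt_of_ne hρ
        have hρS := h.rho_mem hxS
        have hσ : sigma S (rho S x) = x := by
          refine le_antisymm (h.sigma_le hxS hρ') (not_lt.1 fun hlt => ?_)
          have h1 := h.le_rho (h.sigma_mem hρS) hlt
          obtain ⟨s, hs, h2, h3⟩ := h.exists_gt_lt (hρ'.trans_le hx.2) (h1.trans_lt hρ')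
          exact absurd (h.le_rho hs h3) (not_le.2 h2)
        have hFx : F x = F (rho S x) := by
          have := hgap (rho S x) hρS (hρ'.trans_le hx.2) (hσ.trans_ne hρ'.ne')
          rwa [hσ] at this
        refine continuousWithinAt_const.congr_of_eventuallyEq (f := fun _ => F x) ?_ ?_
        · filter_upwards [self_mem_nhdsWithin, mem_nhdsWithin_of_mem_nhds (Ioi_mem_nhds hρ')]
            with z hz hz'
          rcases (mem_Iic.1 hz).lt_or_eq with hlt | rfl
          · rw [h.lastPoint_eq_of_lt_sigma hρS (le_of_lt hz') (hlt.trans_eq hσ.symm), hFx]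
          · rw [h.lastPoint_of_mem hxS]
        · simp only [h.lastPoint_of_mem hxS]
    · have hlt : lastPoint S a x < x := (h.lastPoint_le hax.le).lt_of_ne fun he =>
        hxS (he ▸ h.lastPoint_mem x)
      refine continuousWithinAt_const.congr_of_eventuallyEq (f := fun _ => F (lastPoint S a x)) ?_ rfl
      filter_upwards [self_mem_nhdsWithin, mem_nhdsWithin_of_mem_nhds (Ioi_mem_nhds hlt)]
        with z hz hz'
      have hxb : x < b := hx.2.lt_of_ne fun he => hxS (he ▸ h.right_mem)
      rw [h.lastPoint_eq_of_lt_sigma (h.lastPoint_mem x) (le_of_lt hz')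
        (lt_of_le_of_lt hz (h.lt_sigma_lastPoint hxb hlt))]
  have hcont : ContinuousOn (fun x => F (lastPoint S a x)) (Icc a b) := by
    intro x hx
    have := (hl x hx).union (hr x).continuousWithinAt
    rw [Iic_union_Ici] at this
    exact this.mono (subset_univ _)
  have := constant_of_has_deriv_right_zero hcont (fun x _ => hr x) t (h.subset ht)
  simpa only [h.lastPoint_of_mem ht, h.lastPoint_of_mem h.left_mem] using this

/-! ### The delta integral as a Lebesgue integral -/

/-- The integral `∫_a^t f(r(x)) dx`, where `r(x)` is the last point of `S` before `x`. -/
noncomputable def primitive (S : Set ℝ) (a : ℝ) (f : ℝ → ℝ) (t : ℝ) : ℝ :=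
  ∫ x in a..t, f (lastPoint S a x)

namespace IsTimeInterval

lemma primitive_sub (h : IsTimeInterval S a b) (hf : IsRdBounded S f) (s t : ℝ) :
    primitive S a f t - primitive S a f s = ∫ x in s..t, f (lastPoint S a x) :=
  intervalIntegral.integral_interval_sub_left (hf.intervalIntegrable h _ _)
    (hf.intervalIntegrable h _ _)

lemma continuous_primitive (h : IsTimeInterval S a b) (hf : IsRdBounded S f) :
    Continuous (primitive S a f) :=
  intervalIntegral.continuous_primitive (fun u v => hf.intervalIntegrable h u v) a

lemma primitive_sigma_sub (h : IsTimeInterval S a b) (hf : IsRdBounded S f) (ht : t ∈ S) :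
    primitive S a f (sigma S t) - primitive S a f t = f t * (sigma S t - t) := by
  rw [h.primitive_sub hf]
  have : ∫ x in t..sigma S t, f (lastPoint S a x) = ∫ _ in t..sigma S t, f t := by
    refine intervalIntegral.integral_congr_ae ?_
    have hne : ∀ᵐ x : ℝ, x ≠ sigma S t := by simp [ae_iff]
    filter_upwards [hne] with x hx hx'
    rw [uIoc_of_le (h.le_sigma ht)] at hx'
    rw [h.lastPoint_eq_of_lt_sigma ht hx'.1.le (hx'.2.lt_of_ne hx)]
  rw [this, intervalIntegral.integral_const, smul_eq_mul, mul_comm]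

/-- For x between s and t, both in S, the last point also lies between them, so the integrand stays
ε-close to f t. Being two-sided, the estimate serves delta and nabla derivatives alike. -/
lemma abs_primitive_sub_le (h : IsTimeInterval S a b) (hf : IsRdBounded S f) (ht : t ∈ S)
    (hc : ContinuousWithinAt f S t) {ε : ℝ} (hε : 0 < ε) :
    ∃ δ > 0, ∀ s ∈ S, |s - t| < δ →
      |primitive S a f t - primitive S a f s - f t * (t - s)| ≤ ε * |t - s| := by
  obtain ⟨δ, hδ, H⟩ := Metric.continuousWithinAt_iff.1 hc ε hε
  refine ⟨δ, hδ, fun s hs hst => ?_⟩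
  have h1 : f t * (t - s) = ∫ _ in s..t, f t := by
    rw [intervalIntegral.integral_const, smul_eq_mul, mul_comm]
  rw [h.primitive_sub hf, h1, ← intervalIntegral.integral_sub (hf.intervalIntegrable h _ _)
    intervalIntegrable_const, ← Real.norm_eq_abs]
  refine intervalIntegral.norm_integral_le_of_norm_le_const fun x hx => ?_
  have h2 : |lastPoint S a x - t| ≤ |s - t| := by
    rcases le_total s t with hle | hle
    · rw [uIoc_of_le hle] at hx
      have := le_lastPoint (a := a) hs hx.1.le
      have := h.lastPoint_le ((h.subset hs).1.trans hx.1.le)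
      rw [abs_of_nonpos (by linarith [hx.2]), abs_of_nonpos (by linarith)]
      linarith
    · rw [uIoc_of_ge hle] at hx
      have := le_lastPoint (a := a) ht hx.1.le
      have := h.lastPoint_le ((h.subset ht).1.trans hx.1.le)
      rw [abs_of_nonneg (by linarith), abs_of_nonneg (by linarith)]
      linarith [hx.2]
  exact (H (h.lastPoint_mem x) (h2.trans_lt hst)).le

lemma hasDeltaDerivAt_primitive (h : IsTimeInterval S a b) (hf : IsRdBounded S f) (ht : t ∈ S) :
    HasDeltaDerivAt S (primitive S a f) (f t) t := by
  intro ε hε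
  by_cases hσ : sigma S t = t
  · obtain ⟨δ, hδ, H⟩ := h.abs_primitive_sub_le hf ht (hf.continuousWithinAt t ht hσ) hε
    refine ⟨δ, hδ, fun s hs hst => ?_⟩
    rw [hσ]
    exact H s hs hst
  · have hlt : 0 < sigma S t - t := sub_pos.2 ((h.le_sigma ht).lt_of_ne' hσ)
    -- At a right-scattered t the error is exactly zero at s = t while the allowance ε(σ(t) - t) is
    -- positive, so the inequality persists nearby by continuity.
    have hc : Continuous fun s => |primitive S a f (sigma S t) - primitive S a f s -
        f t * (sigma S t - s)| - ε * |sigma S t - s| := by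
      have := h.continuous_primitive hf
      fun_prop
    have h0 : |primitive S a f (sigma S t) - primitive S a f t -
        f t * (sigma S t - t)| - ε * |sigma S t - t| < 0 := by
      rw [h.primitive_sigma_sub hf ht, sub_self, abs_zero, zero_sub, neg_lt_zero]
      exact mul_pos hε (abs_pos.2 hlt.ne')
    obtain ⟨δ, hδ, H⟩ := Metric.eventually_nhds_iff.1
      (hc.continuousAt.eventually_lt continuousAt_const h0)
    exact ⟨δ, hδ, fun s _ hst => (sub_neg.1 (H hst)).le⟩

lemma deltaIntegral_eq (h : IsTimeInterval S a b) (hf : IsRdBounded S f) {u v : ℝ} (hu : u ∈ S)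
    (hv : v ∈ S) : deltaIntegral S f u v = ∫ x in u..v, f (lastPoint S a x) := by
  have hP : IsDeltaAntideriv S (primitive S a f) f :=
    fun t ht => h.hasDeltaDerivAt_primitive hf ht.1
  have hex : ∃ F, IsDeltaAntideriv S F f := ⟨_, hP⟩
  rw [deltaIntegral, dif_pos hex, ← h.primitive_sub hf]
  -- The antiderivative picked in the definition is arbitrary, but it differs from the primitive by
  -- a constant.
  have key : ∀ t ∈ S, hex.choose t + -1 * primitive S a f t =
      hex.choose a + -1 * primitive S a f a := fun t ht =>
    h.eq_of_hasDeltaDerivAt_zero (F := fun t => hex.choose t + -1 * primitive S a f t)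
      (fun s hs => by
        simpa using (hex.choose_spec s hs).add ((hP s hs).const_mul (-1))) ht
  have h1 := key u hu
  have h2 := key v hv
  linarith

lemma primitive_eq_sub (h : IsTimeInterval S a b) (hf : IsRdBounded S f)
    (hF : IsDeltaAntideriv S F f) (ht : t ∈ S) :
    primitive S a f t = F t - F a := by
  have hP : IsDeltaAntideriv S (primitive S a f) f :=
    fun t ht => h.hasDeltaDerivAt_primitive hf ht.1
  have h1 := h.eq_of_hasDeltaDerivAt_zero (F := fun t => F t + -1 * primitive S a f t)
      (fun s hs => by simpa using (hF s hs).add ((hP s hs).const_mul (-1))) ht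
  have h2 : primitive S a f a = 0 := intervalIntegral.integral_same
  simp only [h2] at h1
  linarith

/-- Integration by parts. -/
lemma integral_parts (h : IsTimeInterval S a b) (hf : IsRdBounded S f) (hg : IsRdBounded S g)
    (hσ : IsRdBounded S fun t => primitive S a g (sigma S t)) (h0 : primitive S a g b = 0) :
    ∫ x in a..b, f (lastPoint S a x) * primitive S a g (sigma S (lastPoint S a x)) =
      - ∫ x in a..b, primitive S a f (lastPoint S a x) * g (lastPoint S a x) := by
  have hPf : IsRdBounded S (primitive S a f) :=
    ((h.continuous_primitive hf).continuousOn).isRdBounded h.isCompact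
  have hA : IsDeltaAntideriv S (fun s => primitive S a f s * primitive S a g s)
      (fun t => f t * primitive S a g (sigma S t) + primitive S a f t * g t) := fun t ht =>
    (h.hasDeltaDerivAt_primitive hf ht.1).mul (h.hasDeltaDerivAt_primitive hg ht.1) ht.1
  have h1 := h.primitive_eq_sub ((hf.mul hσ).add (hPf.mul hg)) hA h.right_mem
  rw [h0, primitive, intervalIntegral.integral_add ((hf.mul hσ).intervalIntegrable h _ _)
    ((hPf.mul hg).intervalIntegrable h _ _)] at h1
  have h2 : primitive S a f a = 0 := intervalIntegral.integral_same
  rw [h2] at h1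
  linarith

end IsTimeInterval

end

section

variable {S : Set ℝ} {a b : ℝ} {f g F G : ℝ → ℝ} {d e t : ℝ}

/-! ### Nabla derivatives, by reflection -/

lemma sigma_reflect (S : Set ℝ) (t : ℝ) : sigma (Neg.neg ⁻¹' S) (-t) = -rho S t := by
  have h1 : (Neg.neg ⁻¹' S) ∩ Ioi (-t) = -(S ∩ Iio t) := by
    ext x
    simp
  by_cases h : (S ∩ Iio t).Nonempty
  · rw [sigma, rho, if_pos h, h1, if_pos (nonempty_neg.2 h), Real.sInf_def, neg_neg]
  · rw [sigma, rho, if_neg h, h1, if_neg fun h' => h (nonempty_neg.1 h')]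

lemma rho_reflect (S : Set ℝ) (t : ℝ) : rho (Neg.neg ⁻¹' S) (-t) = -sigma S t := by
  have := sigma_reflect (Neg.neg ⁻¹' S) (-t)
  have h2 : (Neg.neg ⁻¹' (Neg.neg ⁻¹' S) : Set ℝ) = S := by
    ext x
    simp
  rw [h2, neg_neg] at this
  rw [this, neg_neg]

lemma IsTimeInterval.reflect (h : IsTimeInterval S a b) :
    IsTimeInterval (Neg.neg ⁻¹' S) (-b) (-a) where
  closed := h.closed.preimage continuous_neg
  left_mem := by simpa using h.right_mem
  right_mem := by simpa using h.left_mem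
  subset x hx := ⟨neg_le.1 (h.subset hx).2, le_neg.1 (h.subset hx).1⟩
  lt := neg_lt_neg h.lt

/-- Reflection t ↦ -t exchanges the two jump operators, so nabla facts follow from their delta
counterparts on the reflected time scale. -/
lemma hasNablaDerivAt_iff_reflect :
    HasNablaDerivAt S F d t ↔ HasDeltaDerivAt (Neg.neg ⁻¹' S) (fun x => F (-x)) (-d) (-t) := by
  simp only [HasNablaDerivAt, HasDeltaDerivAt, sigma_reflect, neg_neg]
  refine forall₂_congr fun ε _ => exists_congr fun δ => and_congr_right fun _ => ?_
  rw [(Equiv.neg ℝ).forall_congr_left]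
  refine forall_congr' fun s => ?_
  simp only [Equiv.neg_symm, Equiv.neg_apply, mem_preimage]
  have h1 : |-s - t| = |s - -t| := by rw [← abs_neg]; congr 1; ring
  have h2 : |rho S t - -s| = |-rho S t - s| := by rw [← abs_neg]; congr 1; ring
  have h3 : F (rho S t) - F (-s) - d * (rho S t - -s) =
    F (rho S t) - F (-s) - -d * (-rho S t - s) := by ring
  rw [h1, h2, h3]

lemma IsTimeInterval.mem_kappaLower_iff_reflect (h : IsTimeInterval S a b) :
    t ∈ kappaLower S ↔ -t ∈ kappaUpper (Neg.neg ⁻¹' S) := by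
  rw [h.mem_kappaLower_iff, h.reflect.mem_kappaUpper_iff, rho_reflect]
  simp

lemma HasNablaDerivAt.const_mul (c : ℝ) (hF : HasNablaDerivAt S F d t) :
    HasNablaDerivAt S (fun s => c * F s) (c * d) t := by
  rw [hasNablaDerivAt_iff_reflect] at *
  simpa using HasDeltaDerivAt.const_mul c hF

lemma HasNablaDerivAt.add (hF : HasNablaDerivAt S F d t) (hG : HasNablaDerivAt S G e t) :
    HasNablaDerivAt S (fun s => F s + G s) (d + e) t := by
  rw [hasNablaDerivAt_iff_reflect] at *
  rw [neg_add]
  exact HasDeltaDerivAt.add hF hG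

lemma IsTimeInterval.nablaDeriv_eq (h : IsTimeInterval S a b) (ht : t ∈ kappaLower S)
    (hd : HasNablaDerivAt S F d t) : nablaDeriv S F t = d := by
  have hex : ∃ d, HasNablaDerivAt S F d t := ⟨d, hd⟩
  rw [nablaDeriv, dif_pos hex]
  exact neg_injective (h.reflect.hasDeltaDerivAt_unique (h.mem_kappaLower_iff_reflect.1 ht)
    (hasNablaDerivAt_iff_reflect.1 hex.choose_spec) (hasNablaDerivAt_iff_reflect.1 hd))

lemma hasNablaDerivAt_nablaDeriv (hex : ∃ d, HasNablaDerivAt S F d t) :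
    HasNablaDerivAt S F (nablaDeriv S F t) t := by
  rw [nablaDeriv, dif_pos hex]
  exact hex.choose_spec

/-- A function with vanishing nabla derivative is constant. -/
lemma IsTimeInterval.eq_of_hasNablaDerivAt_zero (h : IsTimeInterval S a b)
    (hF : ∀ t ∈ kappaLower S, HasNablaDerivAt S F 0 t) (ht : t ∈ S) : F t = F b := by
  have := h.reflect.eq_of_hasDeltaDerivAt_zero (F := fun x => F (-x)) (t := -t) (fun s hs => by
    have h1 := hasNablaDerivAt_iff_reflect.1
      (hF (-s) (h.mem_kappaLower_iff_reflect.2 (by simpa using hs)))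
    simpa using h1) (by simpa using ht)
  simpa using this

lemma IsTimeInterval.nablaIntegral_eq_sub (h : IsTimeInterval S a b)
    (hF : IsNablaAntideriv S F f) {u v : ℝ} (hu : u ∈ S) (hv : v ∈ S) :
    nablaIntegral S f u v = F v - F u := by
  have hex : ∃ F, IsNablaAntideriv S F f := ⟨F, hF⟩
  rw [nablaIntegral, dif_pos hex]
  have key : ∀ t ∈ S, hex.choose t + -1 * F t = hex.choose b + -1 * F b := fun t ht =>
    h.eq_of_hasNablaDerivAt_zero (F := fun t => hex.choose t + -1 * F t)
      (fun s hs => by simpa using (hex.choose_spec s hs).add ((hF s hs).const_mul (-1))) ht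
  have h1 := key u hu
  have h2 := key v hv
  linarith

lemma IsTimeInterval.nablaIntegral_const (h : IsTimeInterval S a b) {c : ℝ}
    (hf : ∀ t ∈ kappaLower S, f t = c) {u v : ℝ} (hu : u ∈ S) (hv : v ∈ S) :
    nablaIntegral S f u v = c * (v - u) := by
  have hF : IsNablaAntideriv S (fun t => c * t) f := by
    intro t ht ε hε
    refine ⟨1, one_pos, fun s _ _ => ?_⟩
    rw [hf t ht, ← mul_sub, sub_self, abs_zero]
    positivity
  rw [h.nablaIntegral_eq_sub hF hu hv, mul_sub]

lemma nablaIntegral_congr (hfg : ∀ t ∈ kappaLower S, f t = g t) :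
    nablaIntegral S f = nablaIntegral S g := by
  have : (fun F => IsNablaAntideriv S F f) = fun F => IsNablaAntideriv S F g := by
    funext F
    exact propext (forall₂_congr fun t ht => by rw [hfg t ht])
  funext u v
  unfold nablaIntegral
  rw [this]

/-! ### Variations -/

/-- A continuous function whose primitive is of class `C_⋄^1`: it takes the same values at the
ends of a gap whose right end is right-dense. -/
structure IsTestFunction (S : Set ℝ) (b : ℝ) (η : ℝ → ℝ) : Prop where
  continuous : Continuous η
  gap : ∀ t ∈ S, t < b → rho S t < t → sigma S t = t → η (rho S t) = η t

namespace IsTestFunction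

variable {η θ : ℝ → ℝ}

lemma const (c : ℝ) : IsTestFunction S b fun _ => c := ⟨continuous_const, fun _ _ _ _ _ => rfl⟩

lemma sub (hη : IsTestFunction S b η) (hθ : IsTestFunction S b θ) :
    IsTestFunction S b fun t => η t - θ t where
  continuous := hη.continuous.sub hθ.continuous
  gap t ht hb hρ hσ := by rw [hη.gap t ht hb hρ hσ, hθ.gap t ht hb hρ hσ]

lemma mul (hη : IsTestFunction S b η) (hθ : IsTestFunction S b θ) :
    IsTestFunction S b fun t => η t * θ t where
  continuous := hη.continuous.mul hθ.continuous
  gap t ht hb hρ hσ := by rw [hη.gap t ht hb hρ hσ, hθ.gap t ht hb hρ hσ]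

lemma isRdBounded (hη : IsTestFunction S b η) (h : IsTimeInterval S a b) : IsRdBounded S η :=
  hη.continuous.continuousOn.isRdBounded h.isCompact

lemma hasDeltaDerivAt (hη : IsTestFunction S b η) (h : IsTimeInterval S a b) (ht : t ∈ S) :
    HasDeltaDerivAt S (primitive S a η) (η t) t :=
  h.hasDeltaDerivAt_primitive (hη.isRdBounded h) ht

end IsTestFunction

/-! ### Continuity of the jump operators and of functions on S^κ -/

namespace IsTimeInterval

lemma sigma_rho (h : IsTimeInterval S a b) (ht : t ∈ S) (hρ : rho S t < t) :
    sigma S (rho S t) = t := by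
  have hρS := h.rho_mem ht
  refine le_antisymm (h.sigma_le ht hρ) (not_lt.1 fun hlt => ?_)
  have h1 := h.le_rho (h.sigma_mem hρS) hlt
  obtain ⟨s, hs, h2, h3⟩ := h.exists_gt_lt (hρ.trans_le (h.subset ht).2) (h1.trans_lt hρ)
  exact absurd (h.le_rho hs h3) (not_le.2 h2)

lemma tendsto_sigma (h : IsTimeInterval S a b) (ht : t ∈ S) (hσ : sigma S t = t) :
    Tendsto (sigma S) (𝓝[S] t) (𝓝 t) := by
  refine tendsto_order.2 ⟨fun y hy => ?_, fun y hy => ?_⟩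
  · filter_upwards [self_mem_nhdsWithin, mem_nhdsWithin_of_mem_nhds (Ioi_mem_nhds hy)] with s hs hys
    exact lt_of_lt_of_le hys (h.le_sigma hs)
  · rcases (h.subset ht).2.lt_or_eq with hb | rfl
    · obtain ⟨z, hz, htz, hzy⟩ := h.exists_gt_lt hb (hσ.trans_lt hy)
      filter_upwards [mem_nhdsWithin_of_mem_nhds (Iio_mem_nhds htz)] with s hs
      exact (h.sigma_le hz hs).trans_lt hzy
    · filter_upwards [self_mem_nhdsWithin] with s hs
      exact (h.subset (h.sigma_mem hs)).2.trans_lt hy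

lemma tendsto_rho (h : IsTimeInterval S a b) (ht : t ∈ S) (hρ : rho S t = t) :
    Tendsto (rho S) (𝓝[S] t) (𝓝 t) := by
  refine tendsto_order.2 ⟨fun y hy => ?_, fun y hy => ?_⟩
  · rcases (h.subset ht).1.lt_or_eq with hb | rfl
    · obtain ⟨z, hz, htz, hzy⟩ := h.exists_lt_gt hb (hy.trans_eq hρ.symm)
      filter_upwards [mem_nhdsWithin_of_mem_nhds (Ioi_mem_nhds htz)] with s hs
      exact hzy.trans_le (h.le_rho hz hs)
    · filter_upwards [self_mem_nhdsWithin] with s hs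
      exact hy.trans_le (h.subset (h.rho_mem hs)).1
  · filter_upwards [self_mem_nhdsWithin, mem_nhdsWithin_of_mem_nhds (Iio_mem_nhds hy)] with s hs hys
    exact lt_of_le_of_lt (h.rho_le hs) hys

lemma isClosed_kappaUpper (h : IsTimeInterval S a b) : IsClosed (kappaUpper S) := by
  by_cases hb : rho S b = b
  · have : kappaUpper S = S := by
      ext t
      rw [h.mem_kappaUpper_iff]
      exact ⟨fun ht => ht.1, fun ht => ⟨ht, (h.subset ht).2.lt_or_eq.imp_right fun he => ⟨he, hb⟩⟩⟩
    rw [this]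
    exact h.closed
  · have : kappaUpper S = S ∩ Iic (rho S b) := by
      ext t
      rw [h.mem_kappaUpper_iff]
      refine ⟨fun ht => ⟨ht.1, ?_⟩, fun ht => ⟨ht.1, Or.inl ?_⟩⟩
      · exact h.le_rho ht.1 (ht.2.resolve_right fun he => hb he.2)
      · exact lt_of_le_of_lt ht.2 ((h.rho_le h.right_mem).lt_of_ne hb)
    rw [this]
    exact h.closed.inter isClosed_Iic

lemma isCompact_kappaUpper (h : IsTimeInterval S a b) : IsCompact (kappaUpper S) :=
  isCompact_Icc.of_isClosed_subset h.isClosed_kappaUpper fun _ hx => h.subset hx.1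

/-- Continuity on `S^κ` gives boundedness on `S` and continuity at right-dense points. -/
lemma isRdBounded_of_continuousOn (h : IsTimeInterval S a b)
    (hf : ContinuousOn f (kappaUpper S)) : IsRdBounded S f where
  bounded := by
    obtain ⟨M, hM⟩ := h.isCompact_kappaUpper.exists_bound_of_continuousOn hf
    -- If b is left-scattered, continuity on S^κ says nothing about f b; for a delta derivative this
    -- is an arbitrary value.
    refine ⟨max M |f b|, fun t ht => ?_⟩
    rcases (h.subset ht).2.lt_or_eq with hb | rfl
    · exact (hM t (h.mem_kappaUpper_of_lt ht hb)).trans (le_max_left _ _)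
    · exact le_max_right _ _
  continuousWithinAt t ht hσ := by
    by_cases hk : t ∈ kappaUpper S
    · refine (hf t hk).mono_of_mem_nhdsWithin ?_
      rcases (h.subset ht).2.lt_or_eq with hb | rfl
      · filter_upwards [self_mem_nhdsWithin, mem_nhdsWithin_of_mem_nhds (Iio_mem_nhds hb)]
          with s hs hsb
        exact h.mem_kappaUpper_of_lt hs hsb
      · filter_upwards [self_mem_nhdsWithin] with s hs
        rcases (h.subset hs).2.lt_or_eq with hb | rfl
        · exact h.mem_kappaUpper_of_lt hs hb
        · exact hk
    · have hsb : t = b := by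
        by_contra hne
        exact hk (h.mem_kappaUpper_of_lt ht ((h.subset ht).2.lt_of_ne hne))
      subst hsb
      have hρ : rho S t < t := (h.rho_le ht).lt_of_ne fun he =>
        hk (h.mem_kappaUpper_iff.2 ⟨ht, Or.inr ⟨rfl, he⟩⟩)
      refine continuousWithinAt_const.congr_of_eventuallyEq (f := fun _ => f t) ?_ rfl
      filter_upwards [self_mem_nhdsWithin, mem_nhdsWithin_of_mem_nhds (Ioi_mem_nhds hρ)] with z hz hz'
      rcases (h.subset hz).2.lt_or_eq with hlt | rfl
      · exact absurd (h.le_rho hz hlt) (not_le.2 hz')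
      · rfl

end IsTimeInterval

namespace IsTestFunction

variable {η : ℝ → ℝ}

lemma hasNablaDerivAt (hη : IsTestFunction S b η) (h : IsTimeInterval S a b) (ht : t ∈ S) :
    HasNablaDerivAt S (primitive S a η) (η (rho S t)) t := by
  intro ε hε
  have hf := hη.isRdBounded h
  by_cases hρ : rho S t = t
  · obtain ⟨δ, hδ, H⟩ := h.abs_primitive_sub_le hf ht hη.continuous.continuousWithinAt hε
    refine ⟨δ, hδ, fun s hs hst => ?_⟩
    rw [hρ]
    exact H s hs hst
  · have hlt : rho S t < t := (h.rho_le ht).lt_of_ne hρ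
    have h1 := h.primitive_sigma_sub hf (h.rho_mem ht)
    rw [h.sigma_rho ht hlt] at h1
    have hc : Continuous fun s => |primitive S a η (rho S t) - primitive S a η s -
        η (rho S t) * (rho S t - s)| - ε * |rho S t - s| := by
      have := h.continuous_primitive hf
      fun_prop
    have h0 : |primitive S a η (rho S t) - primitive S a η t -
        η (rho S t) * (rho S t - t)| - ε * |rho S t - t| < 0 := by
      have h2 : primitive S a η (rho S t) - primitive S a η t - η (rho S t) * (rho S t - t) = 0 := by
        linarith
      rw [h2, abs_zero, zero_sub, neg_lt_zero]
      exact mul_pos hε (abs_pos.2 (sub_neg.2 hlt).ne)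
    obtain ⟨δ, hδ, H⟩ := Metric.eventually_nhds_iff.1
      (hc.continuousAt.eventually_lt continuousAt_const h0)
    exact ⟨δ, hδ, fun s _ hst => (sub_neg.1 (H hst)).le⟩

/-- At a left-dense point ρ is continuous. A left-scattered point is either isolated in S or
right-dense and below b. In the latter case ρ(s) tends to t from the right, and the gap condition
matches this limit with η(ρ(t)). -/
lemma continuousOn_comp_rho (hη : IsTestFunction S b η) (h : IsTimeInterval S a b) :
    ContinuousOn (fun t => η (rho S t)) S := by
  intro t ht
  by_cases hρ : rho S t = t
  · have := (hη.continuous.tendsto t).comp (h.tendsto_rho ht hρ)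
    rw [ContinuousWithinAt, hρ]
    exact this
  have hlt : rho S t < t := (h.rho_le ht).lt_of_ne hρ
  have hright : ∀ᶠ s in 𝓝[S] t, t ≤ s := by
    filter_upwards [self_mem_nhdsWithin, mem_nhdsWithin_of_mem_nhds (Ioi_mem_nhds hlt)] with s hs hs'
    exact not_lt.1 fun hst => absurd (h.le_rho hs hst) (not_le.2 hs')
  by_cases hbad : t < b ∧ sigma S t = t
  · have hg := hη.gap t ht hbad.1 hlt hbad.2
    rw [ContinuousWithinAt, hg]
    refine Metric.tendsto_nhds.2 fun ε hε => ?_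
    obtain ⟨δ, hδ, H⟩ := Metric.continuous_iff.1 hη.continuous t ε hε
    filter_upwards [hright, self_mem_nhdsWithin,
      mem_nhdsWithin_of_mem_nhds (Metric.ball_mem_nhds t hδ)] with s hs hsS hsδ
    rcases hs.lt_or_eq with hts | rfl
    · refine H _ ?_
      have h1 := h.le_rho ht hts
      have h2 := h.rho_le hsS
      rw [Metric.mem_ball, Real.dist_eq, abs_of_pos (sub_pos.2 hts)] at hsδ
      rw [Real.dist_eq, abs_of_nonneg (sub_nonneg.2 h1)]
      linarith
    · rwa [hg, dist_self]
  · refine continuousWithinAt_const.congr_of_eventuallyEq (f := fun _ => η (rho S t)) ?_ rfl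
    rcases (h.subset ht).2.lt_or_eq with hb | rfl
    · have hσ : t < sigma S t := (h.le_sigma ht).lt_of_ne' fun he => hbad ⟨hb, he⟩
      filter_upwards [hright, self_mem_nhdsWithin,
        mem_nhdsWithin_of_mem_nhds (Iio_mem_nhds hσ)] with s hs hsS hsσ
      rcases hs.lt_or_eq with hts | rfl
      · exact absurd (h.sigma_le hsS hts) (not_le.2 hsσ)
      · rfl
    · filter_upwards [hright, self_mem_nhdsWithin] with s hs hsS
      rw [le_antisymm (h.subset hsS).2 hs]

end IsTestFunction

lemma IsC1Diamond.continuousOn {y : ℝ → ℝ} (hy : IsC1Diamond S y) (h : IsTimeInterval S a b) :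
    ContinuousOn y S := by
  have hU : ContinuousOn y (kappaUpper S) := by
    intro t ht
    obtain ⟨d, hd⟩ := hy.delta_differentiable t ht
    exact (hd.continuousWithinAt ht.1).mono fun s hs => hs.1
  have hR := h.isRdBounded_of_continuousOn hU
  intro t ht
  by_cases hk : t ∈ kappaUpper S
  · obtain ⟨d, hd⟩ := hy.delta_differentiable t hk
    exact hd.continuousWithinAt ht
  · have hsb : t = b := by
      by_contra hne
      exact hk (h.mem_kappaUpper_of_lt ht ((h.subset ht).2.lt_of_ne hne))
    subst hsb
    exact hR.continuousWithinAt t ht h.sigma_right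

lemma IsC1Diamond.isRdBounded_comp_sigma {y : ℝ → ℝ} (hy : IsC1Diamond S y)
    (h : IsTimeInterval S a b) : IsRdBounded S fun t => y (sigma S t) where
  bounded := by
    obtain ⟨M, hM⟩ := h.isCompact.exists_bound_of_continuousOn (hy.continuousOn h)
    exact ⟨M, fun t ht => hM _ (h.sigma_mem ht)⟩
  continuousWithinAt t ht hσ := by
    rw [ContinuousWithinAt, hσ]
    exact (hy.continuousOn h t ht).tendsto.comp (tendsto_nhdsWithin_iff.2
      ⟨h.tendsto_sigma ht hσ, eventually_mem_nhdsWithin.mono fun s hs => h.sigma_mem hs⟩)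

lemma IsC1Diamond.isRdBounded_deltaDeriv {y : ℝ → ℝ} (hy : IsC1Diamond S y)
    (h : IsTimeInterval S a b) : IsRdBounded S (deltaDeriv S y) :=
  h.isRdBounded_of_continuousOn hy.delta_continuous

/-- The primitive of a test function is of class `C_⋄^1`. -/
lemma IsTestFunction.isC1Diamond_primitive {η : ℝ → ℝ} (hη : IsTestFunction S b η)
    (h : IsTimeInterval S a b) : IsC1Diamond S (primitive S a η) where
  delta_differentiable _ ht := ⟨_, hη.hasDeltaDerivAt h ht.1⟩
  delta_continuous := hη.continuous.continuousOn.congr fun _ ht =>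
    h.deltaDeriv_eq ht (hη.hasDeltaDerivAt h ht.1)
  nabla_differentiable _ ht := ⟨_, hη.hasNablaDerivAt h ht.1⟩
  nabla_continuous := ((hη.continuousOn_comp_rho h).mono fun _ ht => ht.1).congr fun _ ht =>
    h.nablaDeriv_eq ht (hη.hasNablaDerivAt h ht.1)

section

variable {y z : ℝ → ℝ}

lemma IsC1Diamond.deltaDeriv_add_mul (hy : IsC1Diamond S y) (hz : IsC1Diamond S z)
    (h : IsTimeInterval S a b) (c : ℝ) (ht : t ∈ kappaUpper S) :
    deltaDeriv S (fun s => y s + c * z s) t = deltaDeriv S y t + c * deltaDeriv S z t :=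
  h.deltaDeriv_eq ht ((hasDeltaDerivAt_deltaDeriv (hy.delta_differentiable t ht)).add
    ((hasDeltaDerivAt_deltaDeriv (hz.delta_differentiable t ht)).const_mul c))

lemma IsC1Diamond.add_mul (hy : IsC1Diamond S y) (hz : IsC1Diamond S z)
    (h : IsTimeInterval S a b) (c : ℝ) : IsC1Diamond S (fun s => y s + c * z s) where
  delta_differentiable t ht := ⟨_, (hasDeltaDerivAt_deltaDeriv (hy.delta_differentiable t ht)).add
    ((hasDeltaDerivAt_deltaDeriv (hz.delta_differentiable t ht)).const_mul c)⟩
  delta_continuous := (hy.delta_continuous.add (hz.delta_continuous.const_mul c)).congr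
    fun _ ht => hy.deltaDeriv_add_mul hz h c ht
  nabla_differentiable t ht := ⟨_, (hasNablaDerivAt_nablaDeriv (hy.nabla_differentiable t ht)).add
    ((hasNablaDerivAt_nablaDeriv (hz.nabla_differentiable t ht)).const_mul c)⟩
  nabla_continuous := (hy.nabla_continuous.add (hz.nabla_continuous.const_mul c)).congr
    fun t ht => h.nablaDeriv_eq ht
      ((hasNablaDerivAt_nablaDeriv (hy.nabla_differentiable t ht)).add
        ((hasNablaDerivAt_nablaDeriv (hz.nabla_differentiable t ht)).const_mul c))

end

lemma supNorm_le {M : ℝ} (hM : ∀ t ∈ kappaUpper S ∩ kappaLower S, |f t| ≤ M) :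
    supNorm S f ≤ ENNReal.ofReal M :=
  iSup₂_le fun t ht => by
    rw [Real.enorm_eq_ofReal_abs]
    exact ENNReal.ofReal_le_ofReal (hM t ht)

/-- Small multiples of the primitive of a test function are small in `‖·‖_{1,∞}`. -/
lemma IsTestFunction.eventually_norm1Inf_lt {η : ℝ → ℝ} (hη : IsTestFunction S b η)
    (h : IsTimeInterval S a b) {δ : ℝ} (hδ : 0 < δ) :
    ∀ᶠ ε : ℝ in 𝓝 0, norm1Inf S (fun t => ε * primitive S a η t) < ENNReal.ofReal δ := by
  obtain ⟨M, hM⟩ := (hη.isRdBounded h).bounded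
  obtain ⟨N, hN⟩ := (((h.continuous_primitive (hη.isRdBounded h)).continuousOn).isRdBounded
    h.isCompact).bounded
  have hM0 : 0 ≤ M := (abs_nonneg _).trans (hM _ h.left_mem)
  have hN0 : 0 ≤ N := (abs_nonneg _).trans (hN _ h.left_mem)
  have hc : Tendsto (fun ε : ℝ => |ε| * N + |ε| * N + |ε| * M + |ε| * M) (𝓝 0) (𝓝 0) := by
    have : Continuous fun ε : ℝ => |ε| * N + |ε| * N + |ε| * M + |ε| * M := by fun_prop
    simpa using this.tendsto 0
  filter_upwards [hc.eventually_lt_const hδ] with ε hε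
  refine lt_of_le_of_lt ?_ ((ENNReal.ofReal_lt_ofReal_iff hδ).2 hε)
  rw [ENNReal.ofReal_add (by positivity) (by positivity),
    ENNReal.ofReal_add (by positivity) (by positivity),
    ENNReal.ofReal_add (by positivity) (by positivity)]
  have hmul : ∀ x K : ℝ, |x| ≤ K → |ε * x| ≤ |ε| * K := fun x K hx => by
    rw [abs_mul]
    exact mul_le_mul_of_nonneg_left hx (abs_nonneg _)
  refine add_le_add (add_le_add (add_le_add ?_ ?_) ?_) ?_
  · exact supNorm_le fun t ht => hmul _ _ (hN _ (h.sigma_mem ht.1.1))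
  · exact supNorm_le fun t ht => hmul _ _ (hN _ (h.rho_mem ht.1.1))
  · refine supNorm_le fun t ht => ?_
    rw [h.deltaDeriv_eq ht.1 ((hη.hasDeltaDerivAt h ht.1.1).const_mul ε)]
    exact hmul _ _ (hM _ ht.1.1)
  · refine supNorm_le fun t ht => ?_
    rw [h.nablaDeriv_eq ht.2 ((hη.hasNablaDerivAt h ht.1.1).const_mul ε)]
    exact hmul _ _ (hM _ (h.rho_mem ht.1.1))

end

section

variable {S : Set ℝ} {a b : ℝ} {f g F G : ℝ → ℝ} {d e t : ℝ}

/-! ### Test functions with prescribed behaviour -/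

/-- The real numbers, with each gap of `S` whose right end is right-dense collapsed to its left
end. -/
def collapsed (S : Set ℝ) (b : ℝ) : Set ℝ :=
  {x | ∀ t ∈ S, t < b → rho S t < t → sigma S t = t → x ∉ Ioc (rho S t) t}

namespace IsTimeInterval

lemma mem_collapsed_of_lt_sigma (h : IsTimeInterval S a b) (ht : t ∈ S) (hσ : t < sigma S t) :
    t ∈ collapsed S b := by
  intro s _ _ _ hs hmem
  rcases hmem.2.lt_or_eq with hlt | rfl
  · exact absurd (h.le_rho ht hlt) (not_le.2 hmem.1)
  · exact hσ.ne' hs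

lemma right_mem_collapsed : b ∈ collapsed S b := fun _ _ hs _ _ hmem => absurd hmem.2 (not_le.2 hs)

/-- A nearby point z of S is removed only as the right end of a gap. The left end ρ(z) is then
right-scattered, hence kept, and still exceeds s because S has points between s and z. -/
lemma exists_mem_collapsed_gt (h : IsTimeInterval S a b) {s y : ℝ} (hsb : s < b)
    (hσ : sigma S s = s) (hsy : s < y) : ∃ z ∈ S, z ∈ collapsed S b ∧ s < z ∧ z < y := by
  obtain ⟨z, hz, hsz, hzy⟩ := h.exists_gt_lt hsb (hσ.trans_lt hsy)
  by_cases hzc : z ∈ collapsed S b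
  · exact ⟨z, hz, hzc, hsz, hzy⟩
  simp only [collapsed, mem_ofPred_eq, not_forall, not_not] at hzc
  obtain ⟨u, hu, -, hρ, -, hzu⟩ := hzc
  have huz : u = z := by
    rcases hzu.2.lt_or_eq with hlt | he
    · exact absurd (h.le_rho hz hlt) (not_le.2 hzu.1)
    · exact he.symm
  subst huz
  obtain ⟨w, hw, hsw, hwu⟩ := h.exists_gt_lt hsb (hσ.trans_lt hsz)
  exact ⟨rho S u, h.rho_mem hu, h.mem_collapsed_of_lt_sigma (h.rho_mem hu)
    (by rwa [h.sigma_rho hu hρ]), hsw.trans_le (h.le_rho hw hwu), hρ.trans hzy⟩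

/-- If the midpoint was removed with a gap ending at s, then s < y because y was kept, and kept
points accumulate at s from the right. This makes the collapsed line densely ordered. -/
lemma exists_mem_collapsed_lt (h : IsTimeInterval S a b) {x y : ℝ} (hy : y ∈ collapsed S b)
    (hxy : x < y) : ∃ z ∈ collapsed S b, x < z ∧ z < y := by
  by_cases hm : (x + y) / 2 ∈ collapsed S b
  · exact ⟨_, hm, by linarith, by linarith⟩
  simp only [collapsed, mem_ofPred_eq, not_forall, not_not] at hm
  obtain ⟨s, hs, hsb, hρ, hσ, hmem⟩ := hm
  have hsy : s < y := by
    by_contra! hle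
    exact hy s hs hsb hρ hσ ⟨hmem.1.trans (by linarith), hle⟩
  obtain ⟨z, -, hz, hsz, hzy⟩ := h.exists_mem_collapsed_gt hsb hσ hsy
  exact ⟨z, hz, by linarith [hmem.2], hzy⟩

/-- A continuous step function that is constant on the gaps of `S` whose right end is
right-dense. -/
lemma exists_testFunction_step (h : IsTimeInterval S a b) {p q : ℝ} (hp : p ∈ collapsed S b)
    (hq : q ∈ collapsed S b) (hpq : p < q) :
    ∃ η : ℝ → ℝ, IsTestFunction S b η ∧ (∀ x, 0 ≤ η x) ∧ (∀ x, η x ≤ 1) ∧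
      (∀ x ≤ p, η x = 0) ∧ ∀ x, q ≤ x → η x = 1 := by
  let β := {x : ℝ // x ∈ collapsed S b ∧ x ∈ Icc p q}
  have : Nontrivial β := ⟨⟨⟨p, hp, left_mem_Icc.2 hpq.le⟩, ⟨q, hq, right_mem_Icc.2 hpq.le⟩,
    fun he => hpq.ne (congrArg Subtype.val he)⟩⟩
  have : DenselyOrdered β := ⟨fun x y hxy => by
    obtain ⟨z, hz, hxz, hzy⟩ := h.exists_mem_collapsed_lt y.2.1 (show (x : ℝ) < y from hxy)
    exact ⟨⟨z, hz, x.2.2.1.trans hxz.le, hzy.le.trans y.2.2.2⟩, hxz, hzy⟩⟩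
  -- The rationals embed into the kept points of [p, q]. The step function at x is the supremum of
  -- the d in (0, 1) with e d ≤ x; it is continuous because its levels are dense.
  obtain ⟨e⟩ := Order.embedding_from_countable_to_dense ℚ β
  have he : ∀ {c d : ℚ}, c < d → (e c : ℝ) < e d := fun hcd => e.strictMono hcd
  let A : ℝ → Set ℝ := fun x => insert 0 {r | ∃ d : ℚ, 0 < d ∧ d < 1 ∧ (e d : ℝ) ≤ x ∧ r = d}
  have hA1 : ∀ x, ∀ r ∈ A x, r ≤ 1 := by
    rintro x r (rfl | ⟨d, -, hd, -, rfl⟩)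
    · exact zero_le_one
    · exact_mod_cast hd.le
  have hbdd : ∀ x, BddAbove (A x) := fun x => ⟨1, hA1 x⟩
  have hne : ∀ x, (A x).Nonempty := fun x => ⟨0, mem_insert _ _⟩
  have h0 : ∀ x, 0 ≤ sSup (A x) := fun x => le_csSup (hbdd x) (mem_insert _ _)
  have h1 : ∀ x, sSup (A x) ≤ 1 := fun x => csSup_le (hne x) (hA1 x)
  have hge : ∀ (x : ℝ) (d : ℚ), 0 < d → d < 1 → (e d : ℝ) ≤ x → (d : ℝ) ≤ sSup (A x) :=
    fun x d hd0 hd1 hdx => le_csSup (hbdd x) (mem_insert_of_mem _ ⟨d, hd0, hd1, hdx, rfl⟩)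
  have hle : ∀ (x : ℝ) (d : ℚ), 0 < d → x < e d → sSup (A x) ≤ d := by
    refine fun x d hd0 hdx => csSup_le (hne x) ?_
    rintro r (rfl | ⟨c, -, -, hcx, rfl⟩)
    · exact_mod_cast hd0.le
    · have : c < d := by
        by_contra! hdc
        have : (e d : ℝ) ≤ e c := e.monotone hdc
        linarith
      exact_mod_cast this.le
  refine ⟨fun x => sSup (A x), ⟨?_, ?_⟩, h0, h1, ?_, ?_⟩
  · refine continuous_iff_continuousAt.2 fun x => tendsto_order.2 ⟨fun y hy => ?_, fun y hy => ?_⟩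
    · rcases lt_or_ge y 0 with hy0 | hy0
      · exact Eventually.of_forall fun z => hy0.trans_le (h0 z)
      obtain ⟨d, hyd, hdx⟩ := exists_rat_btwn hy
      have hd0 : 0 < d := by exact_mod_cast hy0.trans_lt hyd
      have hd1 : d < 1 := by exact_mod_cast hdx.trans_le (h1 x)
      have hdx' : (e d : ℝ) < x := by
        obtain ⟨r, hr, hdr⟩ := exists_lt_of_lt_csSup (hne x) hdx
        rcases hr with rfl | ⟨c, -, -, hcx, rfl⟩
        · exact absurd hdr (not_lt.2 (by exact_mod_cast hd0.le))
        · exact (he (by exact_mod_cast hdr)).trans_le hcx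
      filter_upwards [Ioi_mem_nhds hdx'] with z hz
      exact hyd.trans_le (hge z d hd0 hd1 (le_of_lt hz))
    · rcases lt_or_ge 1 y with hy1 | hy1
      · exact Eventually.of_forall fun z => (h1 z).trans_lt hy1
      obtain ⟨d, hxd, hdy⟩ := exists_rat_btwn hy
      have hd0 : 0 < d := by exact_mod_cast (h0 x).trans_lt hxd
      have hd1 : d < 1 := by exact_mod_cast hdy.trans_le hy1
      have hdx' : x < e d := not_le.1 fun hle' => absurd (hge x d hd0 hd1 hle') (not_le.2 hxd)
      filter_upwards [Iio_mem_nhds hdx'] with z hz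
      exact (hle z d hd0 hz).trans_lt hdy
  · intro t ht htb hρ hσ
    -- No e d lies in (ρ(t), t], so the same levels are reached at both ends of the gap.
    have : A (rho S t) = A t := by
      refine congrArg (insert 0) (Set.ext fun r => exists_congr fun d => ?_)
      refine and_congr_right fun _ => and_congr_right fun _ => and_congr_left fun _ => ?_
      refine ⟨fun hd => hd.trans hρ.le, fun hd => not_lt.1 fun hlt => ?_⟩
      exact (e d).2.1 t ht htb hρ hσ ⟨hlt, hd⟩
    simp only [this]
  · refine fun x hx => le_antisymm (csSup_le (hne x) ?_) (h0 x)
    rintro r (rfl | ⟨d, -, -, hdx, rfl⟩)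
    · exact le_rfl
    · have h2 := he (sub_one_lt d)
      have h3 := (e (d - 1)).2.2.1
      linarith
  · refine fun x hx => le_antisymm (h1 x) (le_of_forall_lt fun y hy => ?_)
    obtain ⟨d, hyd, hd1⟩ := exists_rat_btwn (max_lt hy one_pos)
    have hd0 : 0 < d := by exact_mod_cast (le_max_right y 0).trans_lt hyd
    exact ((le_max_left y 0).trans_lt hyd).trans_le
      (hge x d hd0 (by exact_mod_cast hd1) ((e d).2.2.2.trans hx))

/-! ### The lemma of du Bois-Reymond -/

variable {ψ φ : ℝ → ℝ}

/-- The test function η₁(1 - η₂) rises before t, equals 1 at t and vanishes soon after σ(t). The gap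
contributes ψ(t)(σ(t) - t) to the integral, and the two transition zones, of length at most δ,
contribute at most 2Mδ. -/
lemma eq_zero_of_lt_sigma (h : IsTimeInterval S a b) (hψ : IsRdBounded S ψ)
    (H : ∀ η, IsTestFunction S b η → ∫ x in a..b, ψ (lastPoint S a x) * η (lastPoint S a x) = 0)
    (ht : t ∈ S) (hσ : t < sigma S t) : ψ t = 0 := by
  obtain ⟨M, hM⟩ := hψ.bounded
  have hM0 : 0 ≤ M := (abs_nonneg _).trans (hM t ht)
  have htc := h.mem_collapsed_of_lt_sigma ht hσ
  have hσS := h.sigma_mem ht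
  have key : ∀ δ > 0, |ψ t| * (sigma S t - t) ≤ 2 * M * δ := by
    intro δ hδ
    obtain ⟨p, hp, hp1, hp2⟩ := h.exists_mem_collapsed_lt htc (sub_lt_self t hδ)
    -- Here q must belong to S, so that the last point is at least q whenever x is. No such demand
    -- falls on p, as the last point never exceeds x ≥ a.
    obtain ⟨q, hqS, hq, hq1, hq2⟩ : ∃ q ∈ S, q ∈ collapsed S b ∧ sigma S t ≤ q ∧
        q ≤ sigma S t + δ := by
      rcases (h.le_sigma hσS).lt_or_eq with hlt | he
      · exact ⟨_, hσS, h.mem_collapsed_of_lt_sigma hσS hlt, le_rfl, by linarith⟩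
      rcases (h.subset hσS).2.lt_or_eq with hlt | he'
      · obtain ⟨z, hz, hzc, hz1, hz2⟩ := h.exists_mem_collapsed_gt hlt he.symm
          (lt_add_of_pos_right _ hδ)
        exact ⟨z, hz, hzc, hz1.le, hz2.le⟩
      · exact ⟨_, hσS, he' ▸ right_mem_collapsed, le_rfl, by linarith⟩
    obtain ⟨η₁, hη₁, h10, h11, h1p, h1t⟩ := h.exists_testFunction_step hp htc hp2
    obtain ⟨η₂, hη₂, h20, h21, h2t, h2q⟩ := h.exists_testFunction_step htc hq (hσ.trans_le hq1)
    have hη : IsTestFunction S b fun x => η₁ x * (1 - η₂ x) :=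
      hη₁.mul ((IsTestFunction.const 1).sub hη₂)
    have hψη := hψ.mul (hη.isRdBounded h)
    have hint := fun u v => hψη.intervalIntegrable h u v
    set g : ℝ → ℝ := fun x => ψ (lastPoint S a x) *
      (η₁ (lastPoint S a x) * (1 - η₂ (lastPoint S a x))) with hg
    have hgM : ∀ x, ‖g x‖ ≤ M := by
      intro x
      rw [hg, Real.norm_eq_abs, abs_mul]
      have h3 : |η₁ (lastPoint S a x) * (1 - η₂ (lastPoint S a x))| ≤ 1 := by
        rw [abs_of_nonneg (mul_nonneg (h10 _) (sub_nonneg.2 (h21 _)))]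
        exact mul_le_one₀ (h11 _) (sub_nonneg.2 (h21 _)) (by linarith [h20 (lastPoint S a x)])
      exact (mul_le_mul (hM _ (h.lastPoint_mem x)) h3 (abs_nonneg _) hM0).trans_eq (mul_one M)
    have hat : a ≤ t := (h.subset ht).1
    have hqb : q ≤ b := (h.subset hqS).2
    set c := max a p with hc
    have i1 : ∫ x in a..c, g x = 0 := by
      refine (intervalIntegral.integral_congr_ae (g := fun _ => 0)
        (Eventually.of_forall fun x hx => ?_)).trans (by simp)
      rw [uIoc_of_le (le_max_left _ _)] at hx
      have hxp : x ≤ p := (le_max_iff.1 hx.2).resolve_left (not_le.2 hx.1)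
      simp only [hg, h1p _ ((h.lastPoint_le hx.1.le).trans hxp), zero_mul, mul_zero]
    have hct : c ≤ t := max_le hat hp2.le
    have i2 : ‖∫ x in c..t, g x‖ ≤ M * |t - c| :=
      intervalIntegral.norm_integral_le_of_norm_le_const fun x _ => hgM x
    have i3 : ∫ x in t..sigma S t, g x = ψ t * (sigma S t - t) := by
      have h4 : ∫ x in t..sigma S t, g x = ∫ _ in t..sigma S t, ψ t := by
        refine intervalIntegral.integral_congr_ae ?_
        have hne : ∀ᵐ x : ℝ, x ≠ sigma S t := by simp [ae_iff]
        filter_upwards [hne] with x hx hx'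
        rw [uIoc_of_le hσ.le] at hx'
        simp only [hg, h.lastPoint_eq_of_lt_sigma ht hx'.1.le (hx'.2.lt_of_ne hx),
          h1t t le_rfl, h2t t le_rfl, sub_zero, mul_one]
      rw [h4, intervalIntegral.integral_const, smul_eq_mul, mul_comm]
    have i4 : ‖∫ x in sigma S t..q, g x‖ ≤ M * |q - sigma S t| :=
      intervalIntegral.norm_integral_le_of_norm_le_const fun x _ => hgM x
    have i5 : ∫ x in q..b, g x = 0 := by
      refine (intervalIntegral.integral_congr_ae (g := fun _ => 0)
        (Eventually.of_forall fun x hx => ?_)).trans (by simp)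
      rw [uIoc_of_le hqb] at hx
      simp only [hg, h2q _ (le_lastPoint hqS hx.1.le), sub_self, mul_zero]
    have htot : ∫ x in a..b, g x = 0 := H _ hη
    rw [← intervalIntegral.integral_add_adjacent_intervals (hint a c) (hint c b),
      ← intervalIntegral.integral_add_adjacent_intervals (hint c t) (hint t b),
      ← intervalIntegral.integral_add_adjacent_intervals (hint t (sigma S t)) (hint _ b),
      ← intervalIntegral.integral_add_adjacent_intervals (hint (sigma S t) q) (hint q b),
      i1, i3, i5] at htot
    have h5 : ψ t * (sigma S t - t) = -(∫ x in c..t, g x) + -∫ x in sigma S t..q, g x := by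
      linarith
    have h6 : |ψ t| * (sigma S t - t) = |ψ t * (sigma S t - t)| := by
      rw [abs_mul, abs_of_pos (sub_pos.2 hσ)]
    rw [h6, h5]
    refine (abs_add_le _ _).trans ?_
    rw [abs_neg, abs_neg]
    rw [Real.norm_eq_abs] at i2 i4
    have h7 : M * |t - c| ≤ M * δ := mul_le_mul_of_nonneg_left (by
      rw [abs_of_nonneg (sub_nonneg.2 hct)]
      linarith [le_max_right a p]) hM0
    have h8 : M * |q - sigma S t| ≤ M * δ := mul_le_mul_of_nonneg_left (by
      rw [abs_of_nonneg (sub_nonneg.2 hq1)]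
      linarith) hM0
    linarith
  by_contra hne
  have hpos : 0 < |ψ t| * (sigma S t - t) := mul_pos (abs_pos.2 hne) (sub_pos.2 hσ)
  have := key (|ψ t| * (sigma S t - t) / (2 * (2 * M + 1))) (by positivity)
  rw [mul_div_assoc', le_div_iff₀ (by positivity)] at this
  nlinarith

/-- A narrow tent around t is a test function because gaps of S avoid its support. If ψ(t) ≠ 0, then
ψ keeps its sign on the support and the integral could not vanish. -/
lemma eq_zero_of_Ioo_subset (h : IsTimeInterval S a b) (hψ : IsRdBounded S ψ)
    (H : ∀ η, IsTestFunction S b η → ∫ x in a..b, ψ (lastPoint S a x) * η (lastPoint S a x) = 0)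
    {r : ℝ} (hr : 0 < r) (hsub : Ioo (t - r) (t + r) ⊆ S) : ψ t = 0 := by
  have ht : t ∈ S := hsub ⟨by linarith, by linarith⟩
  have hσ : sigma S t = t := by
    refine le_antisymm (le_of_forall_gt fun y hy => ?_) (h.le_sigma ht)
    have hlt : t < min y (t + r) := lt_min hy (by linarith)
    obtain ⟨z, hz1, hz2⟩ := exists_between hlt
    exact (h.sigma_le (hsub ⟨by linarith, hz2.trans_le (min_le_right _ _)⟩) hz1).trans_lt
      (hz2.trans_le (min_le_left _ _))
  by_contra hne
  obtain ⟨δ', hδ', hclose⟩ := Metric.continuousWithinAt_iff.1 (hψ.continuousWithinAt t ht hσ)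
    (|ψ t| / 2) (half_pos (abs_pos.2 hne))
  set δ := min δ' r with hδdef
  have hδ : 0 < δ := lt_min hδ' hr
  have hδr : δ ≤ r := min_le_right _ _
  have hη : IsTestFunction S b fun x => max 0 (δ - |x - t|) := by
    refine ⟨by fun_prop, fun s hs hsb hρ hσs => ?_⟩
    have hnot : ∀ x, rho S s < x → x < s → x ∉ S := fun x h1 h2 hx =>
      absurd (h.le_rho hx h2) (not_le.2 h1)
    -- A gap contains no point of S, so it cannot meet the interval (t - δ, t + δ), which lies in S.
    have hcase : s ≤ t - δ ∨ t + δ ≤ rho S s := by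
      by_contra! hcon
      have hlt : max (rho S s) (t - δ) < min s (t + δ) :=
        max_lt (lt_min hρ hcon.2) (lt_min hcon.1 (by linarith))
      obtain ⟨x, hx1, hx2⟩ := exists_between hlt
      refine hnot x ((le_max_left _ _).trans_lt hx1) (hx2.trans_le (min_le_left _ _))
        (hsub ⟨?_, ?_⟩)
      · linarith [le_max_right (rho S s) (t - δ)]
      · linarith [min_le_right s (t + δ)]
    have hz : ∀ x, x ≤ t - δ ∨ t + δ ≤ x → max 0 (δ - |x - t|) = 0 := by
      rintro x (hx | hx)
      · rw [abs_of_nonpos (by linarith)]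
        exact max_eq_left (by linarith)
      · rw [abs_of_nonneg (by linarith)]
        exact max_eq_left (by linarith)
    rw [hz s (hcase.imp_right fun h' => h'.trans hρ.le), hz (rho S s)
      (hcase.imp_left fun h' => hρ.le.trans h')]
  set η : ℝ → ℝ := fun x => max 0 (δ - |x - t|) with hηdef
  have hη0 : ∀ x, 0 ≤ η x := fun x => le_max_left _ _
  have hpt : ∀ x, ψ t ^ 2 / 2 * η (lastPoint S a x) ≤
      ψ t * (ψ (lastPoint S a x) * η (lastPoint S a x)) := by
    intro x
    rcases lt_or_ge |lastPoint S a x - t| δ with hlt | hle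
    · have h1 := hclose (h.lastPoint_mem x) (hlt.trans_le (min_le_left _ _))
      rw [Real.dist_eq] at h1
      rw [← mul_assoc]
      refine mul_le_mul_of_nonneg_right ?_ (hη0 _)
      have h2 : -(ψ t * (ψ (lastPoint S a x) - ψ t)) ≤ |ψ t| * (|ψ t| / 2) := by
        refine (neg_le_abs _).trans ?_
        rw [abs_mul]
        exact mul_le_mul_of_nonneg_left h1.le (abs_nonneg _)
      have h3 : |ψ t| * (|ψ t| / 2) = ψ t ^ 2 / 2 := by
        rw [← mul_div_assoc, abs_mul_abs_self, sq]
      nlinarith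
    · have : η (lastPoint S a x) = 0 := max_eq_left (by linarith)
      rw [this]
      simp
  have hi := (hη.isRdBounded h).intervalIntegrable h
  have hψi := (hψ.mul (hη.isRdBounded h)).intervalIntegrable h
  have h1 : ψ t ^ 2 / 2 * ∫ x in a..b, η (lastPoint S a x) ≤ 0 := by
    have := intervalIntegral.integral_mono_on h.lt.le ((hi a b).const_mul (ψ t ^ 2 / 2))
      ((hψi a b).const_mul (ψ t)) fun x _ => hpt x
    rw [intervalIntegral.integral_const_mul, intervalIntegral.integral_const_mul, H η hη,
      mul_zero] at this
    exact this
  have hmem : ∀ x ∈ Icc t (t + δ / 2), x ∈ S := fun x hx =>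
    hsub ⟨by linarith [hx.1], by linarith [hx.2]⟩
  have h2 : δ / 2 * (δ / 2) ≤ ∫ x in t..t + δ / 2, η (lastPoint S a x) := by
    have := intervalIntegral.integral_mono_on (a := t) (b := t + δ / 2) (by linarith)
      (intervalIntegrable_const (c := δ / 2)) (hi t (t + δ / 2)) fun x hx => by
        rw [h.lastPoint_of_mem (hmem x hx)]
        refine le_max_of_le_right ?_
        rw [abs_of_nonneg (by linarith [hx.1])]
        linarith [hx.2]
    rw [intervalIntegral.integral_const, smul_eq_mul] at this
    linarith
  have h3 : ∫ x in t..t + δ / 2, η (lastPoint S a x) ≤ ∫ x in a..b, η (lastPoint S a x) :=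
    intervalIntegral.integral_mono_interval (h.subset ht).1 (by linarith)
      (h.subset (hmem _ (right_mem_Icc.2 (by linarith)))).2
      (Eventually.of_forall fun x => hη0 _) (hi a b)
  have h4 : 0 < ψ t ^ 2 / 2 := by positivity
  have h5 : 0 < δ / 2 * (δ / 2) := by positivity
  nlinarith [mul_pos h4 (h5.trans_le (h2.trans h3))]

lemma eq_zero_of_frequently (hψ : ContinuousWithinAt ψ S t)
    (hz : ∀ ε > 0, ∃ s ∈ S, |s - t| < ε ∧ ψ s = 0) : ψ t = 0 := by
  by_contra hne
  obtain ⟨δ, hδ, H⟩ := Metric.continuousWithinAt_iff.1 hψ |ψ t| (abs_pos.2 hne)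
  obtain ⟨s, hs, hst, h0⟩ := hz δ hδ
  have := H hs hst
  rw [Real.dist_eq, h0, zero_sub, abs_neg] at this
  exact lt_irrefl _ this

/-- A right-dense t < b is a limit of right-scattered points or of interior points of S, where ψ is
already known to vanish. A left-dense b is a limit of points t < b. -/
lemma eq_zero_of_integral_mul_eq_zero (h : IsTimeInterval S a b) (hψ : IsRdBounded S ψ)
    (H : ∀ η, IsTestFunction S b η → ∫ x in a..b, ψ (lastPoint S a x) * η (lastPoint S a x) = 0)
    (ht : t ∈ kappaUpper S) : ψ t = 0 := by
  have key : ∀ t ∈ S, t < b → ψ t = 0 := by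
    intro t ht htb
    rcases (h.le_sigma ht).lt_or_eq with hlt | he
    · exact h.eq_zero_of_lt_sigma hψ H ht hlt
    refine eq_zero_of_frequently (hψ.continuousWithinAt t ht he.symm) fun ε hε => ?_
    by_cases hs : ∃ s ∈ S, t < s ∧ s < t + ε ∧ s < sigma S s
    · obtain ⟨s, hsS, h1, h2, h3⟩ := hs
      exact ⟨s, hsS, abs_lt.2 ⟨by linarith, by linarith⟩, h.eq_zero_of_lt_sigma hψ H hsS h3⟩
    push Not at hs
    set u := min (t + ε) b with hu
    have htu : t < u := lt_min (by linarith) htb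
    -- A missing point would lie in a gap starting at a right-scattered point of [t, t + ε). There
    -- is none in (t, t + ε) by assumption, and t is right-dense.
    have hall : Ioo t u ⊆ S := by
      intro x hx
      have hxb : x < b := hx.2.trans_le (min_le_right _ _)
      have hxε : x < t + ε := hx.2.trans_le (min_le_left _ _)
      have h1 := h.lastPoint_le ((h.subset ht).1.trans hx.1.le)
      have h2 : t ≤ lastPoint S a x := le_lastPoint ht hx.1.le
      by_contra hxS
      have h3 : lastPoint S a x < x := h1.lt_of_ne fun he => hxS (he ▸ h.lastPoint_mem x)
      have h4 := h.lt_sigma_lastPoint hxb h3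
      rcases h2.lt_or_eq with h5 | h5
      · exact absurd (hs _ (h.lastPoint_mem x) h5 (by linarith)) (not_le.2 (h3.trans h4))
      · rw [← h5, ← he] at h4
        linarith [hx.1]
    refine ⟨(t + u) / 2, hall ⟨by linarith, by linarith⟩, ?_,
      h.eq_zero_of_Ioo_subset hψ H (r := (u - t) / 2) (by linarith) fun x hx =>
        hall ⟨by linarith [hx.1], by linarith [hx.2]⟩⟩
    have : u ≤ t + ε := min_le_left _ _
    exact abs_lt.2 ⟨by linarith, by linarith⟩
  obtain ⟨htS, htb | ⟨rfl, hρ⟩⟩ := h.mem_kappaUpper_iff.1 ht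
  · exact key t htS htb
  · refine eq_zero_of_frequently (hψ.continuousWithinAt t htS h.sigma_right) fun ε hε => ?_
    obtain ⟨s, hs, h1, h2⟩ := h.exists_lt_gt h.lt (y := t - ε) (by linarith)
    exact ⟨s, hs, abs_lt.2 ⟨by linarith, by linarith⟩, key s hs h1⟩

/-- With c and m the means of φ and η, one has ∫(φ - c)η = ∫φ(η - m) = 0, since η - m is a test
function of mean zero. So φ - c is orthogonal to all test functions. -/
lemma exists_eq_const (h : IsTimeInterval S a b) (hφ : IsRdBounded S φ)
    (H : ∀ η, IsTestFunction S b η → primitive S a η b = 0 →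
      ∫ x in a..b, φ (lastPoint S a x) * η (lastPoint S a x) = 0) :
    ∃ c, ∀ t ∈ kappaUpper S, φ t = c := by
  have hba : b - a ≠ 0 := (sub_pos.2 h.lt).ne'
  set c := (∫ x in a..b, φ (lastPoint S a x)) / (b - a) with hc
  refine ⟨c, fun t ht => sub_eq_zero.1 ?_⟩
  refine h.eq_zero_of_integral_mul_eq_zero (ψ := fun t => φ t - c)
    (hφ.sub (IsRdBounded.const c)) (fun η hη => ?_) ht
  set m := primitive S a η b / (b - a) with hm
  have hηi := (hη.isRdBounded h).intervalIntegrable h a b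
  have hφi := hφ.intervalIntegrable h a b
  have hφηi := (hφ.mul (hη.isRdBounded h)).intervalIntegrable h a b
  have hη' : IsTestFunction S b fun t => η t - m := hη.sub (IsTestFunction.const m)
  have h0 : primitive S a (fun t => η t - m) b = 0 := by
    rw [primitive, intervalIntegral.integral_sub hηi intervalIntegrable_const,
      intervalIntegral.integral_const, smul_eq_mul, hm, mul_div_cancel₀ _ hba, primitive, sub_self]
  have h1 := H _ hη' h0
  simp only [mul_sub] at h1
  rw [intervalIntegral.integral_sub hφηi (hφi.mul_const m),
    intervalIntegral.integral_mul_const] at h1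
  simp only [sub_mul]
  rw [intervalIntegral.integral_sub hφηi (hηi.const_mul c), intervalIntegral.integral_const_mul]
  have h2 : c * ∫ x in a..b, η (lastPoint S a x) = (∫ x in a..b, φ (lastPoint S a x)) * m := by
    rw [hc, hm, primitive]
    ring
  rw [h2, h1]

end IsTimeInterval

end

variable {S : Set ℝ} {a b : ℝ} {f g p q : ℝ → ℝ} {t : ℝ} {L G : ℝ → ℝ → ℝ → ℝ}

/-! ### The first variation -/

lemma IsSmoothLagrangian.mono {T : Set ℝ} (hL : IsSmoothLagrangian T L) (hST : S ⊆ T) :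
    IsSmoothLagrangian S L where
  continuous := hL.continuous.mono (prod_mono hST Subset.rfl)
  differentiable2 t ht := hL.differentiable2 t (hST ht)
  differentiable3 t ht := hL.differentiable3 t (hST ht)
  continuous2 := hL.continuous2.mono (prod_mono hST Subset.rfl)
  continuous3 := hL.continuous3.mono (prod_mono hST Subset.rfl)

/-- Jointly continuous partial derivatives give a total derivative in (u, v), to which the chain
rule along a line applies. -/
lemma IsSmoothLagrangian.hasDerivAt_line (hL : IsSmoothLagrangian S L) (ht : t ∈ S)
    (u v c d ε : ℝ) :
    HasDerivAt (fun ε => L t (u + ε * c) (v + ε * d))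
      (partial2 L t (u + ε * c) (v + ε * d) * c + partial3 L t (u + ε * c) (v + ε * d) * d) ε := by
  have hsec : ∀ {H : ℝ → ℝ → ℝ → ℝ},
      ContinuousOn (fun p : ℝ × ℝ × ℝ => H p.1 p.2.1 p.2.2) (S ×ˢ univ) →
      Continuous fun w : ℝ × ℝ => H t w.1 w.2 := fun hH =>
    hH.comp_continuous (f := fun w : ℝ × ℝ => (t, w.1, w.2)) (by fun_prop)
      fun w => ⟨ht, mem_univ _⟩
  have h2 := hsec hL.continuous2
  have h3 := hsec hL.continuous3
  have key := hasStrictFDerivAt_uncurry_coprod (𝕜 := ℝ) (u := (u + ε * c, v + ε * d)) (f := L t)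
    (f₁ := fun x y => partial2 L t x y • ContinuousLinearMap.id ℝ ℝ)
    (f₂ := fun x y => partial3 L t x y • ContinuousLinearMap.id ℝ ℝ)
    (Eventually.of_forall fun w =>
      (hL.differentiable2 t ht w.1 w.2).hasDerivAt.hasFDerivAt.congr_fderiv
        (by ext; simp [partial2, Function.HasUncurry.uncurry]))
    (Eventually.of_forall fun w =>
      (hL.differentiable3 t ht w.1 w.2).hasDerivAt.hasFDerivAt.congr_fderiv
        (by ext; simp [partial3, Function.HasUncurry.uncurry]))
    (h2.smul continuous_const).continuousAt (h3.smul continuous_const).continuousAt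
  have hline : HasDerivAt (fun ε : ℝ => (u + ε * c, v + ε * d)) (c, d) ε := by
    have h4 : HasDerivAt (fun ε : ℝ => u + ε * c) c ε := by
      simpa using ((hasDerivAt_id ε).mul_const c).const_add u
    have h5 : HasDerivAt (fun ε : ℝ => v + ε * d) d ε := by
      simpa using ((hasDerivAt_id ε).mul_const d).const_add v
    exact h4.prodMk h5
  have := key.hasFDerivAt.comp_hasDerivAt ε hline
  simpa [Function.HasUncurry.uncurry, Function.comp_def] using this

lemma exists_abs_le_of_continuousOn (hS : IsCompact S)
    (hG : ContinuousOn (fun p : ℝ × ℝ × ℝ => G p.1 p.2.1 p.2.2) (S ×ˢ univ)) (A B : ℝ) :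
    ∃ K, ∀ t ∈ S, ∀ u v, |u| ≤ A → |v| ≤ B → |G t u v| ≤ K := by
  obtain ⟨K, hK⟩ := (hS.prod (isCompact_Icc.prod isCompact_Icc)).exists_bound_of_continuousOn
    (hG.mono (prod_mono Subset.rfl (subset_univ (Icc (-A) A ×ˢ Icc (-B) B))))
  exact ⟨K, fun t ht u v hu hv => hK (t, u, v) ⟨ht, abs_le.1 hu, abs_le.1 hv⟩⟩

lemma IsRdBounded.comp_lagrangian (hp : IsRdBounded S p) (hq : IsRdBounded S q) (hS : IsCompact S)
    (hG : ContinuousOn (fun p : ℝ × ℝ × ℝ => G p.1 p.2.1 p.2.2) (S ×ˢ univ)) :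
    IsRdBounded S fun t => G t (p t) (q t) where
  bounded := by
    obtain ⟨A, hA⟩ := hp.bounded
    obtain ⟨B, hB⟩ := hq.bounded
    obtain ⟨K, hK⟩ := exists_abs_le_of_continuousOn hS hG A B
    exact ⟨K, fun t ht => hK t ht _ _ (hA t ht) (hB t ht)⟩
  continuousWithinAt t ht hσ :=
    (hG (t, p t, q t) ⟨ht, mem_univ _⟩).comp (f := fun t => (t, p t, q t))
      (continuousWithinAt_id.prodMk
        ((hp.continuousWithinAt t ht hσ).prodMk (hq.continuousWithinAt t ht hσ)))
      fun _ hs => ⟨hs, mem_univ _⟩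

lemma deltaIntegral_congr (hfg : ∀ t ∈ kappaUpper S, f t = g t) :
    deltaIntegral S f = deltaIntegral S g := by
  have : (fun F => IsDeltaAntideriv S F f) = fun F => IsDeltaAntideriv S F g := by
    funext F
    exact propext (forall₂_congr fun t ht => by rw [hfg t ht])
  funext u v
  unfold deltaIntegral
  rw [this]

variable {y η : ℝ → ℝ}

lemma IsTimeInterval.isRdBounded_alongDelta (h : IsTimeInterval S a b) (hy : IsC1Diamond S y)
    (hG : ContinuousOn (fun p : ℝ × ℝ × ℝ => G p.1 p.2.1 p.2.2) (S ×ˢ univ)) :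
    IsRdBounded S (alongDelta S G y) :=
  (hy.isRdBounded_comp_sigma h).comp_lagrangian (hy.isRdBounded_deltaDeriv h) h.isCompact hG

/-- The first variation of the delta functional. -/
lemma IsTimeInterval.hasDerivAt_deltaFunctional (h : IsTimeInterval S a b)
    (hL : IsSmoothLagrangian S L) (hy : IsC1Diamond S y) (hη : IsTestFunction S b η) :
    HasDerivAt (fun ε : ℝ => deltaFunctional S a b L fun t => y t + ε * primitive S a η t)
      (∫ x in a..b, (alongDelta S (partial2 L) y (lastPoint S a x) *
          primitive S a η (sigma S (lastPoint S a x)) +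
        alongDelta S (partial3 L) y (lastPoint S a x) * η (lastPoint S a x))) 0 := by
  have hz := hη.isC1Diamond_primitive h
  have hyσ := hy.isRdBounded_comp_sigma h
  have hyΔ := hy.isRdBounded_deltaDeriv h
  have hzσ := hz.isRdBounded_comp_sigma h
  have hηR := hη.isRdBounded h
  have hlin : ∀ {p q : ℝ → ℝ} (ε : ℝ), IsRdBounded S p → IsRdBounded S q →
      IsRdBounded S fun t => p t + ε * q t := fun ε hp hq =>
    hp.add ((IsRdBounded.const ε).mul hq)
  have hR : ∀ {G : ℝ → ℝ → ℝ → ℝ} (ε : ℝ),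
      ContinuousOn (fun p : ℝ × ℝ × ℝ => G p.1 p.2.1 p.2.2) (S ×ˢ univ) →
      IsRdBounded S fun t => G t (y (sigma S t) + ε * primitive S a η (sigma S t))
        (deltaDeriv S y t + ε * η t) := fun ε hG =>
    (hlin ε hyσ hzσ).comp_lagrangian (hlin ε hyΔ hηR) h.isCompact hG
  set F : ℝ → ℝ → ℝ := fun ε t => L t (y (sigma S t) + ε * primitive S a η (sigma S t))
        (deltaDeriv S y t + ε * η t) with hF
  have hJ : (fun ε : ℝ => deltaFunctional S a b L fun t => y t + ε * primitive S a η t) =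
      fun ε => ∫ x in a..b, F ε (lastPoint S a x) := by
    funext ε
    rw [← h.deltaIntegral_eq (hR ε hL.continuous) h.left_mem h.right_mem, deltaFunctional]
    refine congrFun (congrFun (deltaIntegral_congr fun t ht => ?_) a) b
    rw [alongDelta, hy.deltaDeriv_add_mul hz h ε ht, h.deltaDeriv_eq ht (hη.hasDeltaDerivAt h ht.1)]
  rw [hJ]
  obtain ⟨A, hA⟩ := hyσ.bounded
  obtain ⟨B, hB⟩ := hyΔ.bounded
  obtain ⟨M, hM⟩ := hzσ.bounded
  obtain ⟨N, hN⟩ := hηR.bounded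
  -- For |ε| < 1 the arguments stay in the box of half-widths A + M and B + N, where compactness
  -- bounds both partial derivatives; this gives the dominating constant.
  obtain ⟨K₂, hK₂⟩ := exists_abs_le_of_continuousOn h.isCompact hL.continuous2 (A + M) (B + N)
  obtain ⟨K₃, hK₃⟩ := exists_abs_le_of_continuousOn h.isCompact hL.continuous3 (A + M) (B + N)
  have hbd : ∀ {c d C D ε : ℝ}, |c| ≤ C → |d| ≤ D → ε ∈ Metric.ball (0 : ℝ) 1 →
      |c + ε * d| ≤ C + D := fun {c d C D ε} hc hd hε => by
    rw [mem_ball_zero_iff, Real.norm_eq_abs] at hε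
    refine (abs_add_le _ _).trans (add_le_add hc ?_)
    rw [abs_mul]
    exact (mul_le_mul hε.le hd (abs_nonneg _) zero_le_one).trans_eq (one_mul D)
  set F' : ℝ → ℝ → ℝ := fun ε t =>
    partial2 L t (y (sigma S t) + ε * primitive S a η (sigma S t)) (deltaDeriv S y t + ε * η t) *
      primitive S a η (sigma S t) +
    partial3 L t (y (sigma S t) + ε * primitive S a η (sigma S t)) (deltaDeriv S y t + ε * η t) *
      η t with hF'
  have hF'R : IsRdBounded S (F' 0) := ((hR 0 hL.continuous2).mul hzσ).add
    ((hR 0 hL.continuous3).mul hηR)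
  have key := intervalIntegral.hasDerivAt_integral_of_dominated_loc_of_deriv_le (μ := volume)
    (F := fun ε x => F ε (lastPoint S a x)) (F' := fun ε x => F' ε (lastPoint S a x))
    (bound := fun _ => K₂ * M + K₃ * N) (a := a) (b := b) (x₀ := 0)
    (Metric.ball_mem_nhds (0 : ℝ) one_pos)
    (Eventually.of_forall fun ε =>
      ((hR ε hL.continuous).measurable_comp_lastPoint h).aestronglyMeasurable)
    ((hR 0 hL.continuous).intervalIntegrable h a b)
    (hF'R.measurable_comp_lastPoint h).aestronglyMeasurable
    (Eventually.of_forall fun x _ ε hε => ?_) intervalIntegrable_const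
    (Eventually.of_forall fun x _ ε _ => hL.hasDerivAt_line (h.lastPoint_mem x) _ _ _ _ ε)
  · refine key.2.congr_deriv ?_
    simp only [hF', zero_mul, add_zero, alongDelta]
  · have hx := h.lastPoint_mem x
    have h2 := hK₂ _ hx _ _ (hbd (hA _ hx) (hM _ hx) hε) (hbd (hB _ hx) (hN _ hx) hε)
    have h3 := hK₃ _ hx _ _ (hbd (hA _ hx) (hM _ hx) hε) (hbd (hB _ hx) (hN _ hx) hε)
    refine (norm_add_le _ _).trans (add_le_add ?_ ?_)
    · rw [norm_mul]
      exact mul_le_mul h2 (hM _ hx) (norm_nonneg _) ((abs_nonneg _).trans h2)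
    · rw [norm_mul]
      exact mul_le_mul h3 (hN _ hx) (norm_nonneg _) ((abs_nonneg _).trans h3)

/-- Weak local extremizers of the delta functional satisfy the integral delta Euler–Lagrange
equation. -/
theorem IsTimeInterval.satisfiesDeltaEL (h : IsTimeInterval S a b) (hL : IsSmoothLagrangian S L)
    {α β : ℝ} (hy : IsWeakLocalExtremizer S a b α β (deltaFunctional S a b L) y) :
    SatisfiesDeltaEL S a L y := by
  have hadm : IsAdmissible S a b α β y := hy.elim (fun hm => hm.1) fun hm => hm.1
  have hC := hadm.1
  have hA := h.isRdBounded_alongDelta hC hL.continuous2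
  have hB := h.isRdBounded_alongDelta hC hL.continuous3
  have hPA : IsRdBounded S (primitive S a (alongDelta S (partial2 L) y)) :=
    ((h.continuous_primitive hA).continuousOn).isRdBounded h.isCompact
  -- A test function of mean zero has a primitive vanishing at both ends, so the perturbed function
  -- keeps the boundary values. Fermat's rule then kills the first variation.
  obtain ⟨c, hc⟩ := h.exists_eq_const (hB.sub hPA) fun η hη h0 => by
    have hz := hη.isC1Diamond_primitive h
    have hzσ := hz.isRdBounded_comp_sigma h
    have hηR := hη.isRdBounded h
    have hder := h.hasDerivAt_deltaFunctional hL hC hη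
    have hadm' : ∀ ε : ℝ, IsAdmissible S a b α β fun t => y t + ε * primitive S a η t := fun ε =>
      ⟨hC.add_mul hz h ε, by simp [primitive, hadm.2.1], by simp [h0, hadm.2.2]⟩
    have hnear : ∀ δ > 0, ∀ᶠ ε : ℝ in 𝓝 0,
        norm1Inf S (fun t => y t + ε * primitive S a η t - y t) < ENNReal.ofReal δ :=
      fun δ hδ => by simpa only [add_sub_cancel_left] using hη.eventually_norm1Inf_lt h hδ
    have hzero : (fun t => y t + 0 * primitive S a η t) = y := by simp
    have hvar : ∫ x in a..b, (alongDelta S (partial2 L) y (lastPoint S a x) *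
          primitive S a η (sigma S (lastPoint S a x)) +
        alongDelta S (partial3 L) y (lastPoint S a x) * η (lastPoint S a x)) = 0 := by
      rcases hy with ⟨-, δ, hδ, hmin⟩ | ⟨-, δ, hδ, hmax⟩
      · refine IsLocalMin.hasDerivAt_eq_zero ?_ hder
        filter_upwards [hnear δ hδ] with ε hε
        rw [hzero]
        exact hmin _ (hadm' ε) hε
      · refine IsLocalMax.hasDerivAt_eq_zero ?_ hder
        filter_upwards [hnear δ hδ] with ε hε
        rw [hzero]
        exact hmax _ (hadm' ε) hε
    -- Integrating the ∂₂ term by parts moves the whole variation onto η and leaves ∂₃L - ∫∂₂L as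
    -- its coefficient.
    rw [intervalIntegral.integral_add ((hA.mul hzσ).intervalIntegrable h a b)
      ((hB.mul hηR).intervalIntegrable h a b), h.integral_parts hA hηR hzσ h0] at hvar
    simp only [sub_mul]
    rw [intervalIntegral.integral_sub ((hB.mul hηR).intervalIntegrable h a b)
      ((hPA.mul hηR).intervalIntegrable h a b)]
    linarith
  refine ⟨c, fun t ht => ?_⟩
  rw [deltaEL, h.deltaIntegral_eq hA h.left_mem ht.1]
  exact hc t ht

lemma isWeakLocalExtremizer_of_mul {J I : (ℝ → ℝ) → ℝ} {C α β : ℝ} (hC : C ≠ 0)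
    (hJ : ∀ z, IsAdmissible S a b α β z → J z = I z * C)
    (hy : IsWeakLocalExtremizer S a b α β J y) : IsWeakLocalExtremizer S a b α β I y := by
  rcases hC.lt_or_gt with hneg | hpos
  · rcases hy with ⟨hadm, δ, hδ, H⟩ | ⟨hadm, δ, hδ, H⟩
    · refine Or.inr ⟨hadm, δ, hδ, fun z hz hzδ => ?_⟩
      have := H z hz hzδ
      rw [hJ y hadm, hJ z hz] at this
      exact (mul_le_mul_right_of_neg hneg).1 this
    · refine Or.inl ⟨hadm, δ, hδ, fun z hz hzδ => ?_⟩
      have := H z hz hzδ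
      rw [hJ y hadm, hJ z hz] at this
      exact (mul_le_mul_right_of_neg hneg).1 this
  · rcases hy with ⟨hadm, δ, hδ, H⟩ | ⟨hadm, δ, hδ, H⟩
    · refine Or.inl ⟨hadm, δ, hδ, fun z hz hzδ => ?_⟩
      have := H z hz hzδ
      rw [hJ y hadm, hJ z hz] at this
      exact (mul_le_mul_iff_left₀ hpos).1 this
    · refine Or.inr ⟨hadm, δ, hδ, fun z hz hzδ => ?_⟩
      have := H z hz hzδ
      rw [hJ y hadm, hJ z hz] at this
      exact (mul_le_mul_iff_left₀ hpos).1 this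

/-! ### Nabla Lagrangians that depend only on time -/

lemma partial_eq_zero {l : ℝ → ℝ} (hl : ∀ u v : ℝ, L t u v = l t) (u v : ℝ) :
    partial2 L t u v = 0 ∧ partial3 L t u v = 0 := by
  simp [partial2, partial3, hl]

lemma nablaFunctional_congr {l : ℝ → ℝ} (hl : ∀ t ∈ S, ∀ u v : ℝ, L t u v = l t) (y z : ℝ → ℝ) :
    nablaFunctional S a b L y = nablaFunctional S a b L z := by
  refine congrFun (congrFun (nablaIntegral_congr fun t ht => ?_) a) b
  rw [alongNabla, alongNabla, hl t ht.1, hl t ht.1]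

lemma IsTimeInterval.nablaEL_eq_zero (h : IsTimeInterval S a b)
    (hL : ∀ t ∈ S, ∀ u v : ℝ, partial2 L t u v = 0 ∧ partial3 L t u v = 0) (ht : t ∈ S) :
    nablaEL S a L y t = 0 := by
  rw [nablaEL, h.nablaIntegral_const (f := alongNabla S (partial2 L) y) (c := 0)
    (fun s hs => (hL s hs.1 _ _).1) h.left_mem ht,
    alongNabla, (hL t ht _ _).2]
  simp

lemma IsTimeInterval.satisfiesEL2_iff (h : IsTimeInterval S a b) {LΔ LN : ℝ → ℝ → ℝ → ℝ}
    (hL : ∀ t ∈ S, ∀ u v : ℝ, partial2 LN t u v = 0 ∧ partial3 LN t u v = 0)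
    (hne : nablaFunctional S a b LN y ≠ 0) :
    SatisfiesEL2 S a b LΔ LN y ↔ SatisfiesDeltaEL S a LΔ y := by
  have key : ∀ t ∈ kappaUpper S, nablaFunctional S a b LN y * deltaEL S a LΔ y t
      + deltaFunctional S a b LΔ y * nablaEL S a LN y (sigma S t) =
      nablaFunctional S a b LN y * deltaEL S a LΔ y t := fun t ht => by
    rw [h.nablaEL_eq_zero hL (h.sigma_mem ht.1), mul_zero, add_zero]
  constructor
  · rintro ⟨c, hc⟩
    refine ⟨c / nablaFunctional S a b LN y, fun t ht => ?_⟩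
    rw [eq_div_iff hne, mul_comm, ← key t ht, hc t ht]
  · rintro ⟨c, hc⟩
    refine ⟨nablaFunctional S a b LN y * c, fun t ht => ?_⟩
    rw [key t ht, hc t ht]

end TimeScale

/-! ### The three claims -/

theorem mainTheorem3
    (T : Set ℝ) (hT : IsClosed T) (a b : ℝ) (ha : a ∈ T) (hb : b ∈ T) (hab : a < b)
    (hint : ((T \ {a, b}) ∩ Set.Icc a b).Nonempty)
    (LΔ LN : ℝ → ℝ → ℝ → ℝ)
    (hLΔ : TimeScale.IsSmoothLagrangian T LΔ) (hLN : TimeScale.IsSmoothLagrangian T LN)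
    (hdep : ∃ l : ℝ → ℝ, ∀ t ∈ T, ∀ u v : ℝ, LN t u v = l t)
    (α β : ℝ) :
    -- the partial derivatives of the nabla Lagrangian vanish
    (∀ t ∈ T, ∀ u v : ℝ, TimeScale.partial2 LN t u v = 0 ∧ TimeScale.partial3 LN t u v = 0) ∧
    (∀ ŷ : ℝ → ℝ, TimeScale.IsC1Diamond (TimeScale.interval T a b) ŷ →
      TimeScale.nablaFunctional (TimeScale.interval T a b) a b LN ŷ ≠ 0 →
      -- the second Euler–Lagrange equation takes the form of the delta equation
      (TimeScale.SatisfiesEL2 (TimeScale.interval T a b) a b LΔ LN ŷ ↔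
        TimeScale.SatisfiesDeltaEL (TimeScale.interval T a b) a LΔ ŷ) ∧
      -- and it is satisfied by weak local extremizers
      (TimeScale.IsWeakLocalExtremizer (TimeScale.interval T a b) a b α β
          (TimeScale.deltaNablaFunctional (TimeScale.interval T a b) a b LΔ LN) ŷ →
        TimeScale.SatisfiesDeltaEL (TimeScale.interval T a b) a LΔ ŷ)) ∧
    -- the special case of the delta calculus of variations
    ((∀ t ∈ T, ∀ u v : ℝ, LN t u v = 1 / (b - a)) →
      (∀ y : ℝ → ℝ, TimeScale.IsC1Diamond (TimeScale.interval T a b) y →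
        TimeScale.nablaFunctional (TimeScale.interval T a b) a b LN y = 1 ∧
        TimeScale.deltaNablaFunctional (TimeScale.interval T a b) a b LΔ LN y =
          TimeScale.deltaFunctional (TimeScale.interval T a b) a b LΔ y) ∧
      (∀ ŷ : ℝ → ℝ, TimeScale.IsWeakLocalExtremizer (TimeScale.interval T a b) a b α β
          (TimeScale.deltaFunctional (TimeScale.interval T a b) a b LΔ) ŷ →
        TimeScale.SatisfiesDeltaEL (TimeScale.interval T a b) a LΔ ŷ)) := by
  obtain ⟨l, hl⟩ := hdep
  have h := TimeScale.isTimeInterval_interval hT ha hb hab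
  have hsub : TimeScale.interval T a b ⊆ T := Set.inter_subset_left
  have hpart : ∀ t ∈ T, ∀ u v : ℝ,
      TimeScale.partial2 LN t u v = 0 ∧ TimeScale.partial3 LN t u v = 0 :=
    fun t ht => TimeScale.partial_eq_zero (hl t ht)
  refine ⟨hpart, fun y _ hne => ⟨?_, fun hext => ?_⟩, fun hconst => ⟨fun y _ => ?_, fun y hext => ?_⟩⟩
  · exact h.satisfiesEL2_iff (fun t ht => hpart t (hsub ht)) hne
  -- The constant factor is the value of J_∇ at the extremizer, shared by every competitor.
  · refine h.satisfiesDeltaEL (hLΔ.mono hsub)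
      (TimeScale.isWeakLocalExtremizer_of_mul hne (fun z _ => ?_) hext)
    rw [TimeScale.deltaNablaFunctional,
      TimeScale.nablaFunctional_congr (fun t ht => hl t (hsub ht)) z y]
  · have h1 : TimeScale.nablaFunctional (TimeScale.interval T a b) a b LN y = 1 := by
      rw [TimeScale.nablaFunctional, h.nablaIntegral_const
        (f := TimeScale.alongNabla (TimeScale.interval T a b) LN y) (c := 1 / (b - a))
        (fun t ht => hconst t (hsub ht.1) _ _) h.left_mem h.right_mem]
      exact one_div_mul_cancel (sub_pos.2 hab).ne'
    exact ⟨h1, by rw [TimeScale.deltaNablaFunctional, h1, mul_one]⟩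
  · exact h.satisfiesDeltaEL (hLΔ.mono hsub) hext
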